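/- Let $N\ge 2$ and let $(x_i,y_i)\in\mathbb R^2$, $0\le i\le N$, with $x_0<x_1<\dots<x_N$ equally spaced, i.e. $x_i-x_{i-1}=(x_N-x_0)/N$ for $1\le i\le N$; write $I=[x_0,x_N]$. Let $b$ be the linear (i.e. degree-at-most-one polynomial) function with $b(x_0)=y_0$, $b(x_N)=y_N$; let $h$ be the function on $I$ with $h(x_i)=y_i$ for $0\le i\le N$ that is linear on each $[x_{i-1},x_i]$; and let $L_i$ be the linear function on $I$ with $L_i(x_0)=x_{i-1}$, $L_i(x_N)=x_i$. Let $S:I\to\mathbb R$ be Lipschitz with $0<S(x)<1$ for all $x\in I$, and let $f$ be the generalized affine fractal interpolation function with vertical scaling function $S$, i.e. the continuous function $f:I\to\mathbb R$ whose graph $\Gamma f=\{(x,f(x)):x\in I\}$ satisfies $\Gamma f=\bigcup_{i=1}^N W_i(\Gamma f)$, where $W_i(x,y)=\bigl(L_i(x),\,S(L_i(x))(y-b(x))+h(L_i(x))\bigr)$. For a closed interval $E=[a,c]$, $k\ge 0$ and $1\le j\le N^k$ put $E^k_j=\bigl[a+\tfrac{j-1}{N^k}(c-a),\,a+\tfrac{j}{N^k}(c-a)\bigr]$,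 and let $O_k(f,I)=\sum_{j=1}^{N^k}\sup_{x',x''\in I^k_j}|f(x')-f(x'')|$. For $k\ge1$, $1\le i\le N$, $1\le j\le N^k$ let $\overline s^k_{i,j}$ and $\underline s^k_{i,j}$ be the maximum and the minimum of $|S|$ on $(I_i)^k_j$, where $I_i=[x_{i-1},x_i]$. Let $M_k$ be the $N^k\times N^k$ matrix such that for $1\le i\le N$, $1\le \ell\le N^{k-1}$, $1\le j\le N^k$ $$(M_k)_{(i-1)N^{k-1}+\ell,\;j}=\begin{cases}\overline s^k_{i,j}, & (\ell-1)N<j\le \ell N,\\ 0,&\text{otherwise,}\end{cases}$$ and let $M_k'$ be defined in the same way with $\underline s^k_{i,j}$ in place of $\overline s^k_{i,j}$. Let $\rho(\cdot)$ denote the spectral radius. For a bounded set $E\subset\mathbb R^2$ let $\mathcal N_E(\varepsilon)$ be the number of squares $[k_1\varepsilon,(k_1+1)\varepsilon]\times[k_2\varepsilon,(k_2+1)\varepsilon]$, $k_1,k_2\in\mathbb Z$, that meet $E$; the statement $\dim_B E=d$ means that the lower and the upper limit of $\log\mathcal N_E(\varepsilon)/\log(1/\varepsilon)$ as $\varepsilon\to0+$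 both equal $d$. Then the limits $\lim_{k\to\infty}\rho(M_k)$ and $\lim_{k\to\infty}\rho(M'_k)$ exist and coincide; denote the common value by $\rho_S$. If $\lim_{p\to\infty}O_p(f,I)=\infty$ and $\rho_S>1$, then $$\dim_B\Gamma f=1+\frac{\log\rho_S}{\log N}.$$ Otherwise, $\dim_B\Gamma f=1$. -/

import Mathlib

open Filter Topology

noncomputable section

namespace FIF

/-! ### Box dimension of subsets of the plane -/

/-- The `ε`-coordinate square `[k₁ε, (k₁+1)ε] × [k₂ε, (k₂+1)ε]`. -/
def coordSquare (ε : ℝ) (k : ℤ × ℤ) : Set (ℝ × ℝ) :=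
  Set.Icc (k.1 * ε) ((k.1 + 1) * ε) ×ˢ Set.Icc (k.2 * ε) ((k.2 + 1) * ε)

/-- The number of `ε`-coordinate squares meeting `E` (a finite number if `E` is bounded and
`ε > 0`). -/
def boxCount (E : Set (ℝ × ℝ)) (ε : ℝ) : ℕ :=
  Set.ncard {k : ℤ × ℤ | (coordSquare ε k ∩ E).Nonempty}

/-- Upper box dimension of a bounded set. -/
def upperBoxDim (E : Set (ℝ × ℝ)) : EReal :=
  limsup (fun ε : ℝ => ((Real.log (boxCount E ε) / Real.log (1 / ε) : ℝ) : EReal)) (𝓝[>] 0)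

/-- Lower box dimension of a bounded set. -/
def lowerBoxDim (E : Set (ℝ × ℝ)) : EReal :=
  liminf (fun ε : ℝ => ((Real.log (boxCount E ε) / Real.log (1 / ε) : ℝ) : EReal)) (𝓝[>] 0)

/-- The box dimension of `E` exists and equals `d`. -/
def HasBoxDim (E : Set (ℝ × ℝ)) (d : ℝ) : Prop :=
  lowerBoxDim E = (d : EReal) ∧ upperBoxDim E = (d : EReal)

/-! ### Generalized affine fractal interpolation functions -/

/-- `g` agrees on `E` with a function `t ↦ m t + c`. -/
def IsLinearOn (g : ℝ → ℝ) (E : Set ℝ) : Prop :=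
  ∃ m c : ℝ, ∀ t ∈ E, g t = m * t + c

/-- The interval `[x₀, x_N]` spanned by the nodes. -/
def nodeInterval {N : ℕ} (x : Fin (N + 1) → ℝ) : Set ℝ :=
  Set.Icc (x 0) (x (Fin.last N))

/-- The map `W(x, y) = (ℓ(x), S(ℓ(x)) (y - b(x)) + h(ℓ(x)))`. -/
def ifsMap (b h S ℓ : ℝ → ℝ) (p : ℝ × ℝ) : ℝ × ℝ :=
  (ℓ p.1, S (ℓ p.1) * (p.2 - b p.1) + h (ℓ p.1))

/-- `f` is the generalized affine fractal interpolation function on `[x₀, x_N]` with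
interpolation data `(x_i, y_i)`, `0 ≤ i ≤ N`, and vertical scaling function `S`, where `b` is the
linear function through the two extreme data points, `h` the piecewise linear interpolant of the
data, and `L i` (for `i : Fin N`, counted from `0`) the linear function taking `[x₀, x_N]` onto
`[x_i, x_{i+1}]`: `f` is continuous and its graph is invariant under the resulting iterated
function system. -/
structure IsGeneralizedAffineFIF {N : ℕ} (x y : Fin (N + 1) → ℝ) (b h : ℝ → ℝ)
    (L : Fin N → ℝ → ℝ) (S f : ℝ → ℝ) : Prop where
  b_linear : IsLinearOn b (nodeInterval x)
  b_left : b (x 0) = y 0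
  b_right : b (x (Fin.last N)) = y (Fin.last N)
  h_node : ∀ i : Fin (N + 1), h (x i) = y i
  h_linear : ∀ i : Fin N, IsLinearOn h (Set.Icc (x i.castSucc) (x i.succ))
  L_linear : ∀ i : Fin N, IsLinearOn (L i) (nodeInterval x)
  L_left : ∀ i : Fin N, L i (x 0) = x i.castSucc
  L_right : ∀ i : Fin N, L i (x (Fin.last N)) = x i.succ
  S_continuous : ContinuousOn S (nodeInterval x)
  S_abs_lt_one : ∀ t ∈ nodeInterval x, |S t| < 1
  f_continuous : ContinuousOn f (nodeInterval x)
  graph_invariant : (nodeInterval x).graphOn f =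
    ⋃ i : Fin N, ifsMap b h S (L i) '' (nodeInterval x).graphOn f

/-! ### Oscillations -/

/-- For `E = [a, b]`, the `j`-th (counted from `0`) of the `N ^ k` closed subintervals of equal
length into which `E` is divided. -/
def subInterval (N : ℕ) (a b : ℝ) (k j : ℕ) : Set ℝ :=
  Set.Icc (a + (j : ℝ) / (N : ℝ) ^ k * (b - a)) (a + ((j : ℝ) + 1) / (N : ℝ) ^ k * (b - a))

/-- Oscillation of `g` on `U`: the supremum of `|g s - g t|` over `s, t ∈ U`. -/
def oscillation (g : ℝ → ℝ) (U : Set ℝ) : ℝ :=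
  Metric.diam (g '' U)

/-- The total oscillation `O_k(g, [a, b])`. -/
def totalOsc (N k : ℕ) (g : ℝ → ℝ) (a b : ℝ) : ℝ :=
  ∑ j ∈ Finset.range (N ^ k), oscillation g (subInterval N a b k j)

/-! ### Vertical scaling matrices -/

/-- `I_{i,j}^k` for `I = [a, b]`: divide `I` into `N` equal parts, take the `i`-th one, divide it
into `N ^ k` equal parts and take the `j`-th one (both indices counted from `0`). -/
def subSubInterval (N : ℕ) (a b : ℝ) (k i j : ℕ) : Set ℝ :=
  subInterval N (a + (i : ℝ) / N * (b - a)) (a + ((i : ℝ) + 1) / N * (b - a)) k j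

/-- The maximum of `|S|` over `I_{i,j}^k`. -/
def sUpper (N : ℕ) (a b : ℝ) (S : ℝ → ℝ) (k i j : ℕ) : ℝ :=
  sSup ((fun t => |S t|) '' subSubInterval N a b k i j)

/-- The minimum of `|S|` over `I_{i,j}^k`. -/
def sLower (N : ℕ) (a b : ℝ) (S : ℝ → ℝ) (k i j : ℕ) : ℝ :=
  sInf ((fun t => |S t|) '' subSubInterval N a b k i j)

/-- The `N ^ k × N ^ k` matrix (`k ≥ 1`) whose entry in row `i * N ^ (k - 1) + l`
(`0 ≤ i < N`, `0 ≤ l < N ^ (k - 1)`) and column `j` is `s i j` if `l * N ≤ j < (l + 1) * N`, and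
`0` otherwise. -/
def scalingPattern (N k : ℕ) (s : ℕ → ℕ → ℝ) : Matrix (Fin (N ^ k)) (Fin (N ^ k)) ℝ :=
  Matrix.of fun r j =>
    if ((r : ℕ) % N ^ (k - 1)) * N ≤ (j : ℕ) ∧ (j : ℕ) < ((r : ℕ) % N ^ (k - 1) + 1) * N then
      s ((r : ℕ) / N ^ (k - 1)) (j : ℕ)
    else 0

/-- The vertical scaling matrix `M_k` of level `k ≥ 1` (built from maxima of `|S|`). -/
def upperMatrix (N : ℕ) (a b : ℝ) (S : ℝ → ℝ) (k : ℕ) : Matrix (Fin (N ^ k)) (Fin (N ^ k)) ℝ :=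
  scalingPattern N k (sUpper N a b S k)

/-- The vertical scaling matrix `M'_k` of level `k ≥ 1` (built from minima of `|S|`). -/
def lowerMatrix (N : ℕ) (a b : ℝ) (S : ℝ → ℝ) (k : ℕ) : Matrix (Fin (N ^ k)) (Fin (N ^ k)) ℝ :=
  scalingPattern N k (sLower N a b S k)

/-- Spectral radius of a real square matrix: the largest modulus of a complex eigenvalue. -/
def matrixSpectralRadius {n : ℕ} (X : Matrix (Fin n) (Fin n) ℝ) : ℝ :=
  (spectralRadius ℂ (X.map (fun r : ℝ => (r : ℂ)))).toReal

end FIF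

end

open Filter Topology

noncomputable section

namespace FIF

/-! Everything is governed by the growth rate `ρ` of one transfer operator `T`, `(Tφ)(t) = ∑ S(bᵢ t)
φ(bᵢ t)`, where `bᵢ` maps the interval onto its `i`-th part. Since `S` is Lipschitz and positive,
`log S` is Lipschitz. As the `bᵢ` contract by `N ≥ 2`, `T` preserves the functions whose logarithm
has the same Lipschitz constant `Λ`. Hence the iterates of `T` on `1` have uniformly bounded
distortion, and Fekete's lemma gives `ρ` (`exists_growth_transferIter`). No exact eigenfunction is
needed: truncated geometric sums of these iterates satisfy `Tφ ≥ rφ` for `r < ρ` and `Tφ ≤ rφ` for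
`r > ρ` (`exists_sub_super_eigenfunction`).

These functions are used twice. Sampled on the grid, `φ` is an approximate left sub- or
super-eigenvector of both `M_k` and `M'_k`, because multiplying a row vector by such a matrix is a
discrete version of `T`. Collatz–Wielandt bounds then give both limits
(`matrixSpectralRadius_scalingPattern`). Used as a weight on oscillations, `φ` turns the
self-affinity of `f` into the scalar recursion `x (p + 1) = r x p + O(1)`, with an inequality in
place of equality (`abs_weightedOsc_succ_sub`). Thus the total oscillation grows at most like `r ^
p` for every `r > max ρ 1`. If it diverges and `ρ > 1`, it also grows at least like `r ^ p` for
every `r` in `(1, ρ)`.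

At scale `ε ≈ N ^ (-p)` the box count is comparable to the total oscillation divided by `ε`, plus `N
^ p` (`boxCount_le`, `le_boxCount`). This converts growth of oscillation into dimension. If `ρ ≤ 1`
or the oscillation stays bounded, the dimension is `1`. -/

/-! ### The transfer operator -/

/-- The affine map of `[a, c]` onto the `i`-th of its `N` equal parts. -/
def branch (N : ℕ) (a c : ℝ) (i : ℕ) (t : ℝ) : ℝ :=
  a + (i : ℝ) / N * (c - a) + (t - a) / N

lemma branch_mem {N : ℕ} {a c t : ℝ} {i : ℕ} (hi : i < N) (ht : t ∈ Set.Icc a c) :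
    branch N a c i t ∈ Set.Icc a c := by
  have hN : (0 : ℝ) < N := by exact_mod_cast (by omega : 0 < N)
  have hi' : (i : ℝ) + 1 ≤ N := by exact_mod_cast hi
  obtain ⟨h1, h2⟩ := ht
  have hac : a ≤ c := h1.trans h2
  unfold branch
  constructor
  · have : 0 ≤ (i : ℝ) / N * (c - a) := mul_nonneg (by positivity) (by linarith)
    have : 0 ≤ (t - a) / N := div_nonneg (by linarith) hN.le
    linarith
  · have h3 : (i : ℝ) / N * (c - a) + (t - a) / N ≤ c - a := by
      rw [div_mul_eq_mul_div, ← add_div, div_le_iff₀ hN]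
      nlinarith
    linarith

lemma branch_sub_branch (N : ℕ) (a c : ℝ) (i : ℕ) (s t : ℝ) :
    branch N a c i s - branch N a c i t = (s - t) / N := by
  unfold branch; ring

/-- The transfer operator with weight `S`. -/
def transferOp (N : ℕ) (a c : ℝ) (S φ : ℝ → ℝ) (t : ℝ) : ℝ :=
  ∑ i ∈ Finset.range N, S (branch N a c i t) * φ (branch N a c i t)

/-- `φ` is positive on `E`, and its logarithm is `Λ`-Lipschitz there. -/
def LogLipOn (Λ : ℝ) (E : Set ℝ) (φ : ℝ → ℝ) : Prop :=
  ∀ s ∈ E, 0 < φ s ∧ ∀ t ∈ E, φ s ≤ Real.exp (Λ * |s - t|) * φ t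

lemma LogLipOn.le_of_abs_sub_le {Λ δ : ℝ} {E : Set ℝ} {φ : ℝ → ℝ} (h : LogLipOn Λ E φ)
    {s t : ℝ} (hs : s ∈ E) (ht : t ∈ E) (hst : Λ * |s - t| ≤ δ) : φ s ≤ Real.exp δ * φ t :=
  ((h s hs).2 t ht).trans
    (mul_le_mul_of_nonneg_right (Real.exp_le_exp.2 hst) (h t ht).1.le)

lemma logLipOn_const {Λ : ℝ} (hΛ : 0 ≤ Λ) (E : Set ℝ) {r : ℝ} (hr : 0 < r) :
    LogLipOn Λ E (fun _ => r) := fun s _ => ⟨hr, fun t _ => by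
  have : 1 ≤ Real.exp (Λ * |s - t|) := Real.one_le_exp (by positivity)
  nlinarith⟩

lemma LogLipOn.sum {ι : Type*} {Λ : ℝ} {E : Set ℝ} {u : Finset ι} (hu : u.Nonempty)
    {φ : ι → ℝ → ℝ} (h : ∀ i ∈ u, LogLipOn Λ E (φ i)) :
    LogLipOn Λ E (fun t => ∑ i ∈ u, φ i t) := fun s hs =>
  ⟨Finset.sum_pos (fun i hi => (h i hi s hs).1) hu, fun t ht => by
    rw [Finset.mul_sum]
    exact Finset.sum_le_sum fun i hi => (h i hi s hs).2 t ht⟩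

lemma LogLipOn.const_mul {Λ r : ℝ} {E : Set ℝ} {φ : ℝ → ℝ} (hr : 0 < r) (h : LogLipOn Λ E φ) :
    LogLipOn Λ E (fun t => r * φ t) := fun s hs =>
  ⟨mul_pos hr (h s hs).1, fun t ht => by
    have := mul_le_mul_of_nonneg_left ((h s hs).2 t ht) hr.le
    linarith⟩

/-- With `m > 0` the minimum of `S`, `S s ≤ S t + K|s - t| ≤ (1 + (K/m)|s - t|) S t`, and `1 + z ≤
exp z`. -/
lemma LogLipOn.of_lipschitzOnWith {a c : ℝ} {S : ℝ → ℝ} {K : NNReal} (hac : a ≤ c)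
    (hK : LipschitzOnWith K S (Set.Icc a c)) (hpos : ∀ t ∈ Set.Icc a c, 0 < S t) :
    ∃ m Λ : ℝ, 0 < m ∧ 0 ≤ Λ ∧ (∀ t ∈ Set.Icc a c, m ≤ S t) ∧ LogLipOn Λ (Set.Icc a c) S := by
  obtain ⟨t₀, ht₀, hmin⟩ := isCompact_Icc.exists_isMinOn (Set.nonempty_Icc.2 hac) hK.continuousOn
  have hm := hpos t₀ ht₀
  refine ⟨S t₀, K / S t₀, hm, by positivity, fun t ht => hmin ht, fun s hs => ⟨hpos s hs, ?_⟩⟩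
  intro t ht
  have h1 := hK.dist_le_mul s hs t ht
  rw [Real.dist_eq, Real.dist_eq] at h1
  have h2 := (le_abs_self _).trans h1
  have h3 : S t₀ ≤ S t := hmin ht
  have h4 := Real.add_one_le_exp (K / S t₀ * |s - t|)
  have h5 : K * |s - t| ≤ K / S t₀ * |s - t| * S t := by
    calc (K : ℝ) * |s - t| = K / S t₀ * |s - t| * S t₀ := by field_simp
      _ ≤ _ := by gcongr
  nlinarith [hpos t ht]

/-- A branch at least halves distances, so the factors `S` and `φ` each contribute at most `Λ|s -
t|/2` to the exponent. The constant `Λ` therefore does not deteriorate under iteration. -/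
lemma LogLipOn.transferOp {N : ℕ} (hN : 2 ≤ N) {a c Λ : ℝ} (hΛ : 0 ≤ Λ) {S φ : ℝ → ℝ}
    (hS : LogLipOn Λ (Set.Icc a c) S) (hφ : LogLipOn Λ (Set.Icc a c) φ) :
    LogLipOn Λ (Set.Icc a c) (transferOp N a c S φ) := by
  refine LogLipOn.sum (φ := fun i t => S (branch N a c i t) * φ (branch N a c i t))
    (Finset.nonempty_range_iff.2 (by omega)) fun i hi s hs => ?_
  rw [Finset.mem_range] at hi
  refine ⟨mul_pos (hS _ (branch_mem hi hs)).1 (hφ _ (branch_mem hi hs)).1, fun t ht => ?_⟩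
  have hN' : (2 : ℝ) ≤ N := by exact_mod_cast hN
  have hb : Λ * |branch N a c i s - branch N a c i t| ≤ Λ * |s - t| / 2 := by
    rw [branch_sub_branch, abs_div, abs_of_pos (by linarith : (0 : ℝ) < N), mul_div_assoc]
    gcongr
  have h1 := hS.le_of_abs_sub_le (branch_mem hi hs) (branch_mem hi ht) hb
  have h2 := hφ.le_of_abs_sub_le (branch_mem hi hs) (branch_mem hi ht) hb
  calc _ ≤ _ := mul_le_mul h1 h2 (hφ _ (branch_mem hi hs)).1.le
        (mul_nonneg (Real.exp_pos _).le (hS _ (branch_mem hi ht)).1.le)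
    _ = Real.exp (Λ * |s - t| / 2 + Λ * |s - t| / 2) *
        (S (branch N a c i t) * φ (branch N a c i t)) := by rw [Real.exp_add]; ring
    _ = _ := by rw [add_halves]

lemma transferOp_le_mul {N : ℕ} {a c r : ℝ} {S φ ψ : ℝ → ℝ}
    (hS : ∀ t ∈ Set.Icc a c, 0 < S t) (h : ∀ t ∈ Set.Icc a c, φ t ≤ r * ψ t) :
    ∀ t ∈ Set.Icc a c, transferOp N a c S φ t ≤ r * transferOp N a c S ψ t := fun t ht => by
  unfold transferOp
  rw [Finset.mul_sum]
  refine Finset.sum_le_sum fun i hi => ?_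
  have hb := branch_mem (Finset.mem_range.1 hi) ht
  nlinarith [mul_le_mul_of_nonneg_left (h _ hb) (hS _ hb).le]

lemma iterate_transferOp_le_mul {N : ℕ} {a c r : ℝ} {S φ ψ : ℝ → ℝ}
    (hS : ∀ t ∈ Set.Icc a c, 0 < S t) (h : ∀ t ∈ Set.Icc a c, φ t ≤ r * ψ t) (n : ℕ) :
    ∀ t ∈ Set.Icc a c, (transferOp N a c S)^[n] φ t ≤ r * (transferOp N a c S)^[n] ψ t := by
  induction n with
  | zero => exact h
  | succ n ih =>
    simp only [Function.iterate_succ_apply']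
    exact transferOp_le_mul hS ih

/-- The `n`-th iterate of the transfer operator on the constant function `1`. -/
def transferIter (N : ℕ) (a c : ℝ) (S : ℝ → ℝ) (n : ℕ) : ℝ → ℝ :=
  (transferOp N a c S)^[n] fun _ => 1

lemma transferIter_succ (N : ℕ) (a c : ℝ) (S : ℝ → ℝ) (n : ℕ) :
    transferIter N a c S (n + 1) = transferOp N a c S (transferIter N a c S n) :=
  Function.iterate_succ_apply' _ _ _

lemma LogLipOn.transferIter {N : ℕ} (hN : 2 ≤ N) {a c Λ : ℝ} (hΛ : 0 ≤ Λ) {S : ℝ → ℝ}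
    (hS : LogLipOn Λ (Set.Icc a c) S) (n : ℕ) :
    LogLipOn Λ (Set.Icc a c) (transferIter N a c S n) := by
  induction n with
  | zero => exact logLipOn_const hΛ _ one_pos
  | succ n ih => rw [transferIter_succ]; exact hS.transferOp hN hΛ ih

lemma pow_le_transferIter {N : ℕ} (hN : 2 ≤ N) {a c m : ℝ} (hm : 0 < m) {S : ℝ → ℝ}
    (hS : ∀ t ∈ Set.Icc a c, m ≤ S t) (n : ℕ) :
    ∀ t ∈ Set.Icc a c, m ^ n ≤ transferIter N a c S n t := by
  induction n with
  | zero => intro t _; simp [transferIter]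
  | succ n ih =>
    intro t ht
    rw [transferIter_succ, pow_succ']
    have h0 : 0 ∈ Finset.range N := Finset.mem_range.2 (by omega)
    have hterm : ∀ i ∈ Finset.range N,
        m * m ^ n ≤ S (branch N a c i t) * transferIter N a c S n (branch N a c i t) := by
      intro i hi
      have hb := branch_mem (Finset.mem_range.1 hi) ht
      exact mul_le_mul (hS _ hb) (ih _ hb) (by positivity) (hm.le.trans (hS _ hb))
    exact (hterm 0 h0).trans (Finset.single_le_sum (f := fun i =>
      S (branch N a c i t) * transferIter N a c S n (branch N a c i t))
      (fun i hi => le_trans (by positivity) (hterm i hi)) h0)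

/-- The iterates of the transfer operator grow exponentially at a well-defined rate. -/
lemma exists_growth_transferIter {N : ℕ} (hN : 2 ≤ N) {a c : ℝ} (hac : a < c) {S : ℝ → ℝ}
    {m Λ : ℝ} (hm : 0 < m) (hΛ : 0 ≤ Λ) (hmS : ∀ t ∈ Set.Icc a c, m ≤ S t)
    (hS : LogLipOn Λ (Set.Icc a c) S) :
    ∃ ρ : ℝ, 0 < ρ ∧
      (∀ r, 0 < r → r < ρ → ∀ᶠ n in atTop, ∀ t ∈ Set.Icc a c, r ^ n ≤ transferIter N a c S n t) ∧
      (∀ r, ρ < r → ∀ᶠ n in atTop, ∀ t ∈ Set.Icc a c, transferIter N a c S n t ≤ r ^ n) := by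
  set Z := transferIter N a c S with hZ
  have haI : a ∈ Set.Icc a c := Set.left_mem_Icc.2 hac.le
  have hZL : ∀ n, LogLipOn Λ (Set.Icc a c) (Z n) := fun n => hS.transferIter hN hΛ n
  have hz : ∀ n, 0 < Z n a := fun n => (hZL n a haI).1
  set D := Λ * (c - a) with hD
  have hD0 : 0 ≤ D := mul_nonneg hΛ (by linarith)
  have hdist : ∀ s ∈ Set.Icc a c, ∀ t ∈ Set.Icc a c, Λ * |s - t| ≤ D := by
    intro s hs t ht
    refine mul_le_mul_of_nonneg_left (abs_le.2 ⟨?_, ?_⟩) hΛ <;> linarith [hs.1, hs.2, ht.1, ht.2]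
  have hle : ∀ n, ∀ s ∈ Set.Icc a c, ∀ t ∈ Set.Icc a c, Z n s ≤ Real.exp D * Z n t :=
    fun n s hs t ht => (hZL n).le_of_abs_sub_le hs ht (hdist s hs t ht)
  -- The added `D` pays for replacing the function `Z n` by the constant `exp D * Z n a` inside
  -- `T^k`, which makes `u` exactly subadditive.
  set u : ℕ → ℝ := fun n => D + Real.log (Z n a) with hu
  have hexp : ∀ n, Real.exp D * Z n a = Real.exp (u n) := fun n => by
    rw [hu, Real.exp_add, Real.exp_log (hz n)]
  have hsub : Subadditive u := by
    intro k n
    have h1 : Z (k + n) a ≤ Real.exp D * Z n a * Z k a := by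
      rw [hZ, transferIter, Function.iterate_add_apply]
      refine iterate_transferOp_le_mul (fun t ht => (hS t ht).1) (fun t ht => ?_) k a haI
      rw [mul_one]
      exact hle n t ht a haI
    have h2 := Real.log_le_log (hz _) h1
    rw [Real.log_mul (mul_pos (Real.exp_pos _) (hz n)).ne' (hz k).ne',
      Real.log_mul (Real.exp_pos _).ne' (hz n).ne', Real.log_exp] at h2
    simp only [hu]
    linarith
  have hbdd : BddBelow (Set.range fun n : ℕ => u n / n) := by
    -- The `0` covers the term `n = 0`, where the quotient is `0` by convention.
    refine ⟨min 0 (Real.log m), ?_⟩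
    rintro _ ⟨n, rfl⟩
    rcases Nat.eq_zero_or_pos n with rfl | hn
    · simp
    · have hn' : (0 : ℝ) < n := by exact_mod_cast hn
      refine (min_le_right _ _).trans ?_
      simp only
      rw [le_div_iff₀ hn']
      have := Real.log_le_log (pow_pos hm n) (pow_le_transferIter hN hm hmS n a haI)
      rw [Real.log_pow] at this
      simp only [hu]
      linarith
  have hlim := hsub.tendsto_lim hbdd
  refine ⟨Real.exp hsub.lim, Real.exp_pos _, fun r hr hrρ => ?_, fun r hrρ => ?_⟩
  · have h1 : Real.log r < hsub.lim := (Real.log_lt_iff_lt_exp hr).2 hrρ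
    -- One `D` undoes the shift in `u`, the other is the distortion between `a` and `t`; both vanish
    -- after division by `n`.
    have h2 : Tendsto (fun n : ℕ => u n / n - 2 * D / n) atTop (𝓝 (hsub.lim - 0)) :=
      hlim.sub (tendsto_const_div_atTop_nhds_zero_nat _)
    rw [sub_zero] at h2
    filter_upwards [h2.eventually (lt_mem_nhds h1), eventually_gt_atTop 0] with n hn hn0 t ht
    have hn' : (0 : ℝ) < n := by exact_mod_cast hn0
    rw [← sub_div, lt_div_iff₀ hn'] at hn
    have h3 : r ^ n ≤ Real.exp (u n - 2 * D) := by
      rw [← Real.exp_log (pow_pos hr n), Real.log_pow]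
      exact Real.exp_le_exp.2 (by linarith)
    have h4 := hle n a haI t ht
    have h5 : Real.exp (u n - 2 * D) = Real.exp (-D) * Z n a := by
      rw [show u n - 2 * D = -D + -D + u n by ring, Real.exp_add, ← hexp, Real.exp_add]
      have : Real.exp (-D) * Real.exp D = 1 := by rw [← Real.exp_add]; simp
      linear_combination Real.exp (-D) * Z n a * this
    rw [h5] at h3
    refine h3.trans ?_
    rw [Real.exp_neg, inv_mul_le_iff₀ (Real.exp_pos _)]
    exact h4
  · have hr : 0 < r := (Real.exp_pos _).trans hrρ
    have h1 : hsub.lim < Real.log r := (Real.lt_log_iff_exp_lt hr).2 hrρ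
    filter_upwards [hlim.eventually (gt_mem_nhds h1), eventually_gt_atTop 0] with n hn hn0 t ht
    have hn' : (0 : ℝ) < n := by exact_mod_cast hn0
    rw [div_lt_iff₀ hn'] at hn
    refine (hle n t ht a haI).trans ?_
    rw [hexp, ← Real.exp_log (pow_pos hr n), Real.log_pow]
    exact Real.exp_le_exp.2 (by linarith)

lemma transferOp_sum_smul {ι : Type*} (N : ℕ) (a c : ℝ) (S : ℝ → ℝ) (u : Finset ι) (w : ι → ℝ)
    (φ : ι → ℝ → ℝ) (t : ℝ) :
    transferOp N a c S (fun s => ∑ j ∈ u, w j * φ j s) t =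
      ∑ j ∈ u, w j * transferOp N a c S (φ j) t := by
  simp only [transferOp, Finset.mul_sum]
  rw [Finset.sum_comm]
  exact Finset.sum_congr rfl fun j _ => Finset.sum_congr rfl fun i _ => by ring

/-- Applying the operator shifts the index, so the difference from `r` times the sum telescopes.
Only the end terms survive, and comparing the `n`-th iterate with `r ^ n` decides the sign. -/
lemma transferOp_geom_sum {N : ℕ} {a c r : ℝ} {S : ℝ → ℝ} (hr : 0 < r) (n : ℕ) (t : ℝ) :
    transferOp N a c S (fun s => ∑ k ∈ Finset.range n, r⁻¹ ^ k * transferIter N a c S k s) t =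
      r * (∑ k ∈ Finset.range n, r⁻¹ ^ k * transferIter N a c S k t) +
        r * (r⁻¹ ^ n * transferIter N a c S n t - 1) := by
  rw [transferOp_sum_smul]
  have h1 := Finset.sum_range_succ (fun k => r⁻¹ ^ k * transferIter N a c S k t) n
  rw [Finset.sum_range_succ'] at h1
  have h0 : transferIter N a c S 0 t = 1 := rfl
  rw [h0] at h1
  have h2 : ∑ k ∈ Finset.range n, r⁻¹ ^ k * transferOp N a c S (transferIter N a c S k) t =
      r * ∑ k ∈ Finset.range n, r⁻¹ ^ (k + 1) * transferIter N a c S (k + 1) t := by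
    rw [Finset.mul_sum]
    refine Finset.sum_congr rfl fun k _ => ?_
    rw [transferIter_succ, pow_succ']
    field_simp
  rw [h2]
  linear_combination r * h1

/-- There are positive sub- and super-eigenfunctions of the transfer operator for eigenvalues
arbitrarily close to its growth rate. -/
lemma exists_sub_super_eigenfunction {N : ℕ} (hN : 2 ≤ N) {a c : ℝ} (hac : a < c) {S : ℝ → ℝ}
    {m Λ : ℝ} (hm : 0 < m) (hΛ : 0 ≤ Λ) (hmS : ∀ t ∈ Set.Icc a c, m ≤ S t)
    (hS : LogLipOn Λ (Set.Icc a c) S) :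
    ∃ ρ : ℝ, 0 < ρ ∧
      (∀ r, 0 < r → r < ρ → ∃ φ, LogLipOn Λ (Set.Icc a c) φ ∧
        ∀ t ∈ Set.Icc a c, r * φ t ≤ transferOp N a c S φ t) ∧
      (∀ r, ρ < r → ∃ φ, LogLipOn Λ (Set.Icc a c) φ ∧
        ∀ t ∈ Set.Icc a c, transferOp N a c S φ t ≤ r * φ t) := by
  obtain ⟨ρ, hρ, hlow, hupp⟩ := exists_growth_transferIter hN hac hm hΛ hmS hS
  have hlip : ∀ r : ℝ, 0 < r → ∀ n : ℕ, 0 < n → LogLipOn Λ (Set.Icc a c)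
      (fun s => ∑ k ∈ Finset.range n, r⁻¹ ^ k * transferIter N a c S k s) := fun r hr n hn =>
    LogLipOn.sum (φ := fun k s => r⁻¹ ^ k * transferIter N a c S k s)
      (Finset.nonempty_range_iff.2 hn.ne') fun k _ =>
      (hS.transferIter hN hΛ k).const_mul (by positivity)
  refine ⟨ρ, hρ, fun r hr hrρ => ?_, fun r hrρ => ?_⟩
  · obtain ⟨n, hn, hn0⟩ := ((hlow r hr hrρ).and (eventually_gt_atTop 0)).exists
    refine ⟨_, hlip r hr n hn0, fun t ht => ?_⟩
    rw [transferOp_geom_sum hr]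
    have : 1 ≤ r⁻¹ ^ n * transferIter N a c S n t := by
      rw [inv_pow, le_inv_mul_iff₀ (pow_pos hr n), mul_one]; exact hn t ht
    nlinarith
  · have hr := hρ.trans hrρ
    obtain ⟨n, hn, hn0⟩ := ((hupp r hrρ).and (eventually_gt_atTop 0)).exists
    refine ⟨_, hlip r hr n hn0, fun t ht => ?_⟩
    rw [transferOp_geom_sum hr]
    have : r⁻¹ ^ n * transferIter N a c S n t ≤ 1 := by
      rw [inv_pow, inv_mul_le_iff₀ (pow_pos hr n), mul_one]; exact hn t ht
    nlinarith

/-! ### Spectral radii of nonnegative matrices -/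

/-- Collatz–Wielandt: for an eigenvector `v` with eigenvalue `k`, pair `‖k‖ |v| ≤ X |v|` with the
positive left vector `g`, and cancel `∑ g i ‖v i‖ > 0`. -/
lemma spectralRadius_map_le {n : ℕ} {X : Matrix (Fin n) (Fin n) ℝ} (hX : ∀ i j, 0 ≤ X i j)
    {g : Fin n → ℝ} (hg : ∀ i, 0 < g i) {r : ℝ} (h : ∀ j, ∑ i, g i * X i j ≤ r * g j) :
    spectralRadius ℂ (X.map (fun t : ℝ => (t : ℂ))) ≤ ENNReal.ofReal r := by
  refine iSup₂_le fun k hk => ?_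
  set Y : Matrix (Fin n) (Fin n) ℂ := X.map (fun t : ℝ => (t : ℂ)) with hY
  rw [spectrum.mem_iff, Matrix.isUnit_iff_isUnit_det, isUnit_iff_ne_zero, not_not] at hk
  obtain ⟨v, hv0, hv⟩ := Matrix.exists_mulVec_eq_zero_iff.2 hk
  rw [Matrix.sub_mulVec, sub_eq_zero] at hv
  have hv' : ∀ i, k * v i = ∑ j, (X i j : ℂ) * v j := by
    intro i
    have := congrFun hv i
    rw [Algebra.algebraMap_eq_smul_one, Matrix.smul_mulVec, Matrix.one_mulVec] at this
    simpa [Matrix.mulVec, dotProduct, hY] using this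
  have h1 : ∀ i, ‖k‖ * ‖v i‖ ≤ ∑ j, X i j * ‖v j‖ := by
    intro i
    rw [← norm_mul, hv' i]
    refine (norm_sum_le _ _).trans (le_of_eq (Finset.sum_congr rfl fun j _ => ?_))
    rw [norm_mul, Complex.norm_real, Real.norm_of_nonneg (hX i j)]
  have h2 : ‖k‖ * ∑ i, g i * ‖v i‖ ≤ r * ∑ i, g i * ‖v i‖ := by
    calc ‖k‖ * ∑ i, g i * ‖v i‖ = ∑ i, g i * (‖k‖ * ‖v i‖) := by
          rw [Finset.mul_sum]; exact Finset.sum_congr rfl fun _ _ => by ring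
      _ ≤ ∑ i, g i * ∑ j, X i j * ‖v j‖ :=
          Finset.sum_le_sum fun i _ => mul_le_mul_of_nonneg_left (h1 i) (hg i).le
      _ = ∑ j, (∑ i, g i * X i j) * ‖v j‖ := by
          simp only [Finset.mul_sum, Finset.sum_mul]
          rw [Finset.sum_comm]
          exact Finset.sum_congr rfl fun _ _ => Finset.sum_congr rfl fun _ _ => by ring
      _ ≤ ∑ j, (r * g j) * ‖v j‖ :=
          Finset.sum_le_sum fun j _ => mul_le_mul_of_nonneg_right (h j) (norm_nonneg _)
      _ = r * ∑ i, g i * ‖v i‖ := by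
          rw [Finset.mul_sum]; exact Finset.sum_congr rfl fun _ _ => by ring
  obtain ⟨i₀, hi₀⟩ := Function.ne_iff.1 hv0
  have h3 : 0 < ∑ i, g i * ‖v i‖ :=
    Finset.sum_pos' (fun i _ => mul_nonneg (hg i).le (norm_nonneg _))
      ⟨i₀, Finset.mem_univ _, mul_pos (hg i₀) (norm_pos_iff.2 hi₀)⟩
  have h4 := le_of_mul_le_mul_right h2 h3
  exact (ofReal_norm k).symm.le.trans (ENNReal.ofReal_le_ofReal h4)

lemma matrixSpectralRadius_le {n : ℕ} {X : Matrix (Fin n) (Fin n) ℝ} (hX : ∀ i j, 0 ≤ X i j)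
    {g : Fin n → ℝ} (hg : ∀ i, 0 < g i) {r : ℝ} (hr : 0 ≤ r)
    (h : ∀ j, ∑ i, g i * X i j ≤ r * g j) : matrixSpectralRadius X ≤ r :=
  ENNReal.toReal_le_of_le_ofReal hr (spectralRadius_map_le hX hg h)

lemma pow_mul_le_sum_mul_pow {n : ℕ} {X : Matrix (Fin n) (Fin n) ℝ} (hX : ∀ i j, 0 ≤ X i j)
    {g : Fin n → ℝ} {r : ℝ} (hr : 0 ≤ r) (h : ∀ j, r * g j ≤ ∑ i, g i * X i j) (k : ℕ) :
    ∀ j, r ^ k * g j ≤ ∑ i, g i * (X ^ k) i j := by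
  induction k with
  | zero => intro j; simp [Matrix.one_apply]
  | succ k ih =>
    intro j
    calc r ^ (k + 1) * g j = r ^ k * (r * g j) := by ring
      _ ≤ r ^ k * ∑ i, g i * X i j := mul_le_mul_of_nonneg_left (h j) (by positivity)
      _ = ∑ i, (r ^ k * g i) * X i j := by
          rw [Finset.mul_sum]; exact Finset.sum_congr rfl fun _ _ => by ring
      _ ≤ ∑ i, (∑ l, g l * (X ^ k) l i) * X i j :=
          Finset.sum_le_sum fun i _ => mul_le_mul_of_nonneg_right (ih i) (hX i j)
      _ = ∑ l, g l * (X ^ (k + 1)) l j := by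
          simp only [pow_succ, Matrix.mul_apply, Finset.mul_sum, Finset.sum_mul]
          rw [Finset.sum_comm]
          exact Finset.sum_congr rfl fun _ _ => Finset.sum_congr rfl fun _ _ => by ring

section Gelfand

attribute [local instance] Matrix.linftyOpNormedRing
attribute [local instance] Matrix.linftyOpNormedAlgebra

/-- Iterating the hypothesis makes a weighted column sum of `X ^ k` at least a constant times `r ^
k`. The norm of `X ^ k` dominates its entries, so it is at least `κ * r ^ k`, and Gelfand's formula
removes `κ` because `κ ^ (1/k) → 1`. -/
lemma le_matrixSpectralRadius {n : ℕ} (hn : 0 < n) {X : Matrix (Fin n) (Fin n) ℝ}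
    (hX : ∀ i j, 0 ≤ X i j) {g : Fin n → ℝ} (hg : ∀ i, 0 < g i) {r : ℝ} (hr : 0 < r)
    (h : ∀ j, r * g j ≤ ∑ i, g i * X i j) : r ≤ matrixSpectralRadius X := by
  set Y : Matrix (Fin n) (Fin n) ℂ := X.map (fun t : ℝ => (t : ℂ)) with hY
  have j₀ : Fin n := ⟨0, hn⟩
  have hG : 0 < ∑ i, g i := Finset.sum_pos (fun i _ => hg i) ⟨j₀, Finset.mem_univ _⟩
  -- Finiteness is needed before Gelfand's limit can be transported through `ENNReal.toReal`. The
  -- crude `R` makes `g` a super-eigenvector.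
  have hfin : spectralRadius ℂ Y ≠ ⊤ := by
    set R : ℝ := ∑ j, (∑ i, g i * X i j) / g j
    have hterm : ∀ j, 0 ≤ (∑ i, g i * X i j) / g j := fun j =>
      div_nonneg (Finset.sum_nonneg fun i _ => mul_nonneg (hg i).le (hX i j)) (hg j).le
    refine ne_top_of_le_ne_top ENNReal.ofReal_ne_top
      (spectralRadius_map_le hX hg (r := R) fun j => ?_)
    rw [← div_le_iff₀ (hg j)]
    exact Finset.single_le_sum (f := fun j => (∑ i, g i * X i j) / g j)
      (fun j _ => hterm j) (Finset.mem_univ j)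
  have hYpow : ∀ k : ℕ, Y ^ k = (X ^ k).map (fun t : ℝ => (t : ℂ)) := fun k =>
    (Matrix.map_pow X Complex.ofRealHom k).symm
  have hentry : ∀ (A : Matrix (Fin n) (Fin n) ℂ) (i j : Fin n), ‖A i j‖ ≤ ‖A‖ := by
    intro A i j
    rw [← coe_nnnorm, ← coe_nnnorm, NNReal.coe_le_coe, Matrix.linfty_opNNNorm_def]
    exact (Finset.single_le_sum (f := fun j => ‖A i j‖₊) (fun _ _ => zero_le)
      (Finset.mem_univ j)).trans (Finset.le_sup (f := fun i => ∑ j, ‖A i j‖₊) (Finset.mem_univ i))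
  set κ := g j₀ / ∑ i, g i with hκ
  have hκ0 : 0 < κ := div_pos (hg j₀) hG
  have hnorm : ∀ k : ℕ, κ * r ^ k ≤ ‖Y ^ k‖ := by
    intro k
    have h1 := pow_mul_le_sum_mul_pow hX hr.le h k j₀
    have h2 : ∑ i, g i * (X ^ k) i j₀ ≤ ∑ i, g i * ‖Y ^ k‖ := by
      refine Finset.sum_le_sum fun i _ => mul_le_mul_of_nonneg_left ?_ (hg i).le
      refine le_trans ?_ (hentry (Y ^ k) i j₀)
      rw [hYpow, Matrix.map_apply, Complex.norm_real]
      exact le_abs_self _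
    rw [← Finset.sum_mul] at h2
    rw [hκ, div_mul_eq_mul_div, div_le_iff₀ hG]
    linarith
  have hlim := (ENNReal.tendsto_toReal hfin).comp
    (spectrum.pow_norm_pow_one_div_tendsto_nhds_spectralRadius Y)
  have hlim2 : Tendsto (fun k : ℕ => κ ^ (1 / k : ℝ) * r) atTop (𝓝 (κ ^ (0 : ℝ) * r)) := by
    refine Tendsto.mul_const _ ?_
    exact (Real.continuousAt_const_rpow hκ0.ne').tendsto.comp
      tendsto_one_div_atTop_nhds_zero_nat
  rw [Real.rpow_zero, one_mul] at hlim2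
  refine le_of_tendsto_of_tendsto hlim2 hlim ?_
  filter_upwards [eventually_gt_atTop 0] with k hk
  have hk' : (0 : ℝ) < k := by exact_mod_cast hk
  simp only [Function.comp]
  rw [ENNReal.toReal_ofReal (by positivity)]
  calc κ ^ (1 / k : ℝ) * r = (κ * r ^ k) ^ (1 / k : ℝ) := by
        rw [Real.mul_rpow hκ0.le (by positivity), one_div, Real.pow_rpow_inv_natCast hr.le hk.ne']
    _ ≤ ‖Y ^ k‖ ^ (1 / k : ℝ) := Real.rpow_le_rpow (by positivity) (hnorm k) (by positivity)

end Gelfand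

/-! ### Spectral radii of the vertical scaling matrices -/

lemma sum_range_mul_eq (m n : ℕ) (F : ℕ → ℝ) :
    ∑ r ∈ Finset.range (m * n), F r =
      ∑ i ∈ Finset.range m, ∑ l ∈ Finset.range n, F (i * n + l) := by
  induction m with
  | zero => simp
  | succ m ih => rw [Nat.succ_mul, Finset.sum_range_add, ih, Finset.sum_range_succ]

/-- In column `j`, the block of rows belonging to `i` has its only pattern position at offset `j /
N`. The product thus collapses to one term per branch, the shape of `transferOp`. -/
lemma sum_mul_scalingPattern {N : ℕ} (hN : 0 < N) (k : ℕ) (s : ℕ → ℕ → ℝ) (g : ℕ → ℝ)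
    (j : Fin (N ^ (k + 1))) :
    ∑ r : Fin (N ^ (k + 1)), g r * scalingPattern N (k + 1) s r j =
      ∑ i ∈ Finset.range N, g (i * N ^ k + j / N) * s i j := by
  set F : ℕ → ℝ := fun r => g r *
    if (r % N ^ k) * N ≤ (j : ℕ) ∧ (j : ℕ) < (r % N ^ k + 1) * N then s (r / N ^ k) j else 0
    with hF
  have h1 : ∑ r : Fin (N ^ (k + 1)), g r * scalingPattern N (k + 1) s r j =
      ∑ r : Fin (N ^ (k + 1)), F r := by
    refine Finset.sum_congr rfl fun r _ => ?_
    simp [hF, scalingPattern]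
  have hNk : 0 < N ^ k := pow_pos hN k
  have h2 := sum_range_mul_eq N (N ^ k) F
  rw [← pow_succ'] at h2
  rw [h1, Fin.sum_univ_eq_sum_range F, h2]
  refine Finset.sum_congr rfl fun i _ => ?_
  have hj : (j : ℕ) / N < N ^ k := by
    rw [Nat.div_lt_iff_lt_mul hN, ← pow_succ]; exact j.2
  rw [Finset.sum_eq_single_of_mem ((j : ℕ) / N) (Finset.mem_range.2 hj)]
  · have e1 : (i * N ^ k + (j : ℕ) / N) % N ^ k = j / N := by
      rw [Nat.mul_add_mod', Nat.mod_eq_of_lt hj]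
    have e2 : (i * N ^ k + (j : ℕ) / N) / N ^ k = i := by
      rw [mul_comm, Nat.mul_add_div hNk, Nat.div_eq_of_lt hj, add_zero]
    simp only [hF, e1, e2]
    rw [if_pos ⟨Nat.div_mul_le_self _ _, by rw [mul_comm]; exact Nat.lt_mul_div_succ _ hN⟩]
  · intro l hl hne
    have hl' := Finset.mem_range.1 hl
    have e1 : (i * N ^ k + l) % N ^ k = l := by
      rw [Nat.mul_add_mod', Nat.mod_eq_of_lt hl']
    simp only [hF, e1]
    rw [if_neg, mul_zero]
    rintro ⟨h2, h3⟩
    exact hne (Nat.div_eq_of_lt_le h2 h3).symm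

/-- The left end point of the `j`-th of the `N ^ k` equal parts of `[a, c]`. -/
def leftPt (N : ℕ) (a c : ℝ) (k j : ℕ) : ℝ := a + (j : ℝ) / (N : ℝ) ^ k * (c - a)

lemma leftPt_mem {N : ℕ} (hN : 0 < N) {a c : ℝ} (hac : a ≤ c) {k j : ℕ} (hj : j ≤ N ^ k) :
    leftPt N a c k j ∈ Set.Icc a c := by
  have hNk : (0 : ℝ) < (N : ℝ) ^ k := by positivity
  have h1 : (j : ℝ) / (N : ℝ) ^ k ≤ 1 := by
    rw [div_le_one hNk]; exact_mod_cast hj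
  have h2 : 0 ≤ (j : ℝ) / (N : ℝ) ^ k := by positivity
  unfold leftPt
  constructor <;> nlinarith

lemma branch_leftPt {N : ℕ} (hN : 0 < N) (a c : ℝ) (k i j : ℕ) :
    branch N a c i (leftPt N a c k j) = leftPt N a c (k + 1) (i * N ^ k + j) := by
  have : (N : ℝ) ≠ 0 := by positivity
  unfold branch leftPt
  push_cast
  field_simp
  ring

lemma subInterval_eq (N : ℕ) (a c : ℝ) (k j : ℕ) :
    subInterval N a c k j = Set.Icc (leftPt N a c k j) (leftPt N a c k (j + 1)) := by
  simp [subInterval, leftPt]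

lemma leftPt_succ (N : ℕ) (a c : ℝ) (k j : ℕ) :
    leftPt N a c k (j + 1) = leftPt N a c k j + (c - a) / (N : ℝ) ^ k := by
  unfold leftPt; push_cast; ring

lemma subInterval_subset {N : ℕ} (hN : 0 < N) {a c : ℝ} (hac : a ≤ c) {k j : ℕ}
    (hj : j < N ^ k) : subInterval N a c k j ⊆ Set.Icc a c := by
  rw [subInterval_eq]
  exact Set.Icc_subset_Icc (leftPt_mem hN hac hj.le).1 (leftPt_mem hN hac hj).2

lemma subSubInterval_eq {N : ℕ} (hN : 0 < N) (a c : ℝ) (k i j : ℕ) :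
    subSubInterval N a c k i j = subInterval N a c (k + 1) (i * N ^ k + j) := by
  have : (N : ℝ) ≠ 0 := by positivity
  unfold subSubInterval subInterval
  push_cast
  congr 1 <;> field_simp <;> ring

lemma add_lt_pow_succ {N k i j : ℕ} (hi : i < N) (hj : j < N ^ k) :
    i * N ^ k + j < N ^ (k + 1) := by
  rw [pow_succ']
  calc i * N ^ k + j < i * N ^ k + N ^ k := by omega
    _ = (i + 1) * N ^ k := by ring
    _ ≤ N * N ^ k := Nat.mul_le_mul_right _ hi

/-- The reference point is the left end of the subinterval, so log-Lipschitz control applies. The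
length `(c - a) / N ^ (k + 1)` is relaxed to `(c - a) / N ^ k` to match the error in
`leftPt_parent_dist`. -/
lemma scale_bounds {N : ℕ} (hN : 0 < N) {a c Λ : ℝ} (hac : a ≤ c) (hΛ : 0 ≤ Λ) {S : ℝ → ℝ}
    (hS : LogLipOn Λ (Set.Icc a c) S) {k i j : ℕ} (hi : i < N) (hj : j < N ^ k) :
    ∀ t ∈ subSubInterval N a c k i j,
      Real.exp (-(Λ * ((c - a) / N ^ k))) * S (branch N a c i (leftPt N a c k j)) ≤ |S t| ∧
      |S t| ≤ Real.exp (Λ * ((c - a) / N ^ k)) * S (branch N a c i (leftPt N a c k j)) := by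
  intro t ht
  have hlt := add_lt_pow_succ hi hj
  rw [subSubInterval_eq hN] at ht
  have htI := subInterval_subset hN hac hlt ht
  rw [branch_leftPt hN]
  rw [subInterval_eq, leftPt_succ] at ht
  have hb := leftPt_mem hN hac hlt.le (a := a) (c := c)
  have hle : (c - a) / (N : ℝ) ^ (k + 1) ≤ (c - a) / (N : ℝ) ^ k := by
    have h1 : (1 : ℝ) ≤ N := by exact_mod_cast hN
    exact div_le_div_of_nonneg_left (by linarith) (by positivity)
      (pow_le_pow_right₀ h1 (Nat.le_succ k))
  have hd : Λ * |t - leftPt N a c (k + 1) (i * N ^ k + j)| ≤ Λ * ((c - a) / N ^ k) := by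
    refine mul_le_mul_of_nonneg_left ?_ hΛ
    rw [abs_of_nonneg (by linarith [ht.1])]
    linarith [ht.2]
  have hd' := hd
  rw [abs_sub_comm] at hd'
  rw [abs_of_pos (hS t htI).1]
  refine ⟨?_, hS.le_of_abs_sub_le htI hb hd⟩
  rw [Real.exp_neg, inv_mul_le_iff₀ (Real.exp_pos _)]
  exact hS.le_of_abs_sub_le hb htI hd'

lemma subSubInterval_nonempty {N : ℕ} (hN : 0 < N) {a c : ℝ} (hac : a ≤ c) (k i j : ℕ) :
    (subSubInterval N a c k i j).Nonempty := by
  rw [subSubInterval_eq hN, subInterval_eq, leftPt_succ]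
  refine Set.nonempty_Icc.2 ?_
  have : 0 ≤ (c - a) / (N : ℝ) ^ (k + 1) := div_nonneg (by linarith) (by positivity)
  linarith

lemma sUpper_bounds {N : ℕ} (hN : 0 < N) {a c Λ : ℝ} (hac : a ≤ c) (hΛ : 0 ≤ Λ) {S : ℝ → ℝ}
    (hS : LogLipOn Λ (Set.Icc a c) S) {k i j : ℕ} (hi : i < N) (hj : j < N ^ k) :
    Real.exp (-(Λ * ((c - a) / N ^ k))) * S (branch N a c i (leftPt N a c k j)) ≤
        sUpper N a c S k i j ∧
      sUpper N a c S k i j ≤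
        Real.exp (Λ * ((c - a) / N ^ k)) * S (branch N a c i (leftPt N a c k j)) := by
  have h := scale_bounds hN hac hΛ hS hi hj
  obtain ⟨t, ht⟩ := subSubInterval_nonempty hN hac k i j
  constructor
  · refine (h t ht).1.trans (le_csSup
      ⟨Real.exp (Λ * ((c - a) / N ^ k)) * S (branch N a c i (leftPt N a c k j)), ?_⟩ ⟨t, ht, rfl⟩)
    rintro _ ⟨s, hs, rfl⟩
    exact (h s hs).2
  · refine csSup_le ⟨_, t, ht, rfl⟩ ?_
    rintro _ ⟨s, hs, rfl⟩
    exact (h s hs).2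

lemma sLower_bounds {N : ℕ} (hN : 0 < N) {a c Λ : ℝ} (hac : a ≤ c) (hΛ : 0 ≤ Λ) {S : ℝ → ℝ}
    (hS : LogLipOn Λ (Set.Icc a c) S) {k i j : ℕ} (hi : i < N) (hj : j < N ^ k) :
    Real.exp (-(Λ * ((c - a) / N ^ k))) * S (branch N a c i (leftPt N a c k j)) ≤
        sLower N a c S k i j ∧
      sLower N a c S k i j ≤
        Real.exp (Λ * ((c - a) / N ^ k)) * S (branch N a c i (leftPt N a c k j)) := by
  have h := scale_bounds hN hac hΛ hS hi hj
  obtain ⟨t, ht⟩ := subSubInterval_nonempty hN hac k i j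
  constructor
  · refine le_csInf ⟨_, t, ht, rfl⟩ ?_
    rintro _ ⟨s, hs, rfl⟩
    exact (h s hs).1
  · refine le_trans (csInf_le
      ⟨Real.exp (-(Λ * ((c - a) / N ^ k))) * S (branch N a c i (leftPt N a c k j)), ?_⟩ ⟨t, ht, rfl⟩) (h t ht).2
    rintro _ ⟨s, hs, rfl⟩
    exact (h s hs).1

/-- The matrix reads its vector at a level `k + 1` grid point, whereas the branch image lies on
level `k + 2`. The former is the left end of the coarse cell containing the latter, since `j / N`
drops the last base-`N` digit. -/
lemma leftPt_parent_dist {N : ℕ} (hN : 0 < N) {a c : ℝ} (hac : a ≤ c) (k i j : ℕ) :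
    |leftPt N a c (k + 1) (i * N ^ k + j / N) - branch N a c i (leftPt N a c (k + 1) j)| ≤
      (c - a) / N ^ (k + 1) := by
  have hN' : (0 : ℝ) < N := by exact_mod_cast hN
  have h1 : ((j / N : ℕ) : ℝ) * N ≤ j := by exact_mod_cast Nat.div_mul_le_self j N
  have h2 : (j : ℝ) ≤ ((j / N : ℕ) : ℝ) * N + N := by
    have := (Nat.lt_mul_div_succ j hN).le
    have h3 : (j : ℝ) ≤ N * ((j / N : ℕ) + 1) := by exact_mod_cast this
    linarith
  have h3 : leftPt N a c (k + 1) (i * N ^ k + j / N) - branch N a c i (leftPt N a c (k + 1) j) =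
      ((((j / N : ℕ) : ℝ) * N - j) / N) * ((c - a) / N ^ (k + 1)) := by
    unfold leftPt branch
    push_cast
    field_simp
    ring
  rw [h3, abs_mul, abs_of_nonneg (div_nonneg (sub_nonneg.2 hac) (by positivity) :
    0 ≤ (c - a) / (N : ℝ) ^ (k + 1))]
  refine mul_le_of_le_one_left (div_nonneg (sub_nonneg.2 hac) (by positivity)) ?_
  rw [abs_div, abs_of_pos hN', div_le_one hN', abs_le]
  constructor <;> linarith

/-- A matrix with the scaling pattern whose entries are close to the values of `S` has spectral
radius close to the growth rate of the transfer operator. -/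
lemma matrixSpectralRadius_scalingPattern {N : ℕ} (hN : 0 < N) {a c Λ ρ δ : ℝ} (hac : a ≤ c)
    (hρ : 0 < ρ) {S : ℝ → ℝ} (hS : LogLipOn Λ (Set.Icc a c) S) (hΛ : 0 ≤ Λ)
    (hsub : ∀ r, 0 < r → r < ρ → ∃ φ, LogLipOn Λ (Set.Icc a c) φ ∧
        ∀ t ∈ Set.Icc a c, r * φ t ≤ transferOp N a c S φ t)
    (hsup : ∀ r, ρ < r → ∃ φ, LogLipOn Λ (Set.Icc a c) φ ∧
        ∀ t ∈ Set.Icc a c, transferOp N a c S φ t ≤ r * φ t)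
    (k : ℕ) (s : ℕ → ℕ → ℝ) (hδ : δ = Λ * ((c - a) / N ^ (k + 1)))
    (hs : ∀ i < N, ∀ j < N ^ (k + 1),
      Real.exp (-δ) * S (branch N a c i (leftPt N a c (k + 1) j)) ≤ s i j ∧
      s i j ≤ Real.exp δ * S (branch N a c i (leftPt N a c (k + 1) j))) :
    Real.exp (-(2 * δ)) * ρ ≤ matrixSpectralRadius (scalingPattern N (k + 1) s) ∧
      matrixSpectralRadius (scalingPattern N (k + 1) s) ≤ Real.exp (2 * δ) * ρ := by
  have hbm : ∀ i < N, ∀ j < N ^ (k + 1),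
      branch N a c i (leftPt N a c (k + 1) j) ∈ Set.Icc a c := fun i hi j hj =>
    branch_mem hi (leftPt_mem hN hac hj.le)
  have hspos : ∀ i < N, ∀ j < N ^ (k + 1), 0 < s i j := fun i hi j hj =>
    (mul_pos (Real.exp_pos _) (hS _ (hbm i hi j hj)).1).trans_le (hs i hi j hj).1
  have hX : ∀ r j, 0 ≤ scalingPattern N (k + 1) s r j := by
    intro r j
    simp only [scalingPattern, Matrix.of_apply, Nat.add_sub_cancel]
    split_ifs
    · refine (hspos _ ?_ _ j.2).le
      rw [Nat.div_lt_iff_lt_mul (pow_pos hN k), ← pow_succ']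
      exact r.2
    · exact le_rfl
  have hpar : ∀ i < N, ∀ j < N ^ (k + 1),
      leftPt N a c (k + 1) (i * N ^ k + j / N) ∈ Set.Icc a c := fun i hi j hj =>
    leftPt_mem hN hac (add_lt_pow_succ hi
      ((Nat.div_lt_iff_lt_mul hN).2 (by rw [← pow_succ]; exact hj))).le
  have hg : ∀ φ, LogLipOn Λ (Set.Icc a c) φ → ∀ r : Fin (N ^ (k + 1)),
      0 < φ (leftPt N a c (k + 1) r) := fun φ hφ r => (hφ _ (leftPt_mem hN hac r.2.le)).1
  have hdist : ∀ i j, Λ * |leftPt N a c (k + 1) (i * N ^ k + j / N) -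
      branch N a c i (leftPt N a c (k + 1) j)| ≤ δ := fun i j => by
    rw [hδ]; exact mul_le_mul_of_nonneg_left (leftPt_parent_dist hN hac k i j) hΛ
  constructor
  · have key : ∀ r, 0 < r → r < ρ →
        Real.exp (-(2 * δ)) * r ≤ matrixSpectralRadius (scalingPattern N (k + 1) s) := by
      intro r hr hrρ
      obtain ⟨φ, hφ, hφr⟩ := hsub r hr hrρ
      -- The left vector is `φ` at the grid points. One factor `exp (-δ)` compares an entry with
      -- `S`, the other moves `φ` from the branch image to the grid point.
      refine le_matrixSpectralRadius (pow_pos hN _) hX (hg φ hφ) (by positivity) fun j => ?_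
      rw [sum_mul_scalingPattern hN k s (fun r => φ (leftPt N a c (k + 1) r))]
      rw [mul_assoc]
      refine (mul_le_mul_of_nonneg_left (hφr _ (leftPt_mem hN hac j.2.le))
        (Real.exp_pos _).le).trans ?_
      rw [transferOp, Finset.mul_sum]
      refine Finset.sum_le_sum fun i hi => ?_
      have hi' := Finset.mem_range.1 hi
      have h1 := hφ.le_of_abs_sub_le (δ := δ) (hbm i hi' j j.2) (hpar i hi' j j.2)
        (by rw [abs_sub_comm]; exact hdist i j)
      rw [← inv_mul_le_iff₀ (Real.exp_pos _), ← Real.exp_neg] at h1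
      calc _ = (Real.exp (-δ) * φ (branch N a c i (leftPt N a c (k + 1) j))) *
            (Real.exp (-δ) * S (branch N a c i (leftPt N a c (k + 1) j))) := by
            rw [show -(2 * δ) = -δ + -δ by ring, Real.exp_add]; ring
        _ ≤ _ := mul_le_mul h1 (hs i hi' j j.2).1
            (mul_nonneg (Real.exp_pos _).le (hS _ (hbm i hi' j j.2)).1.le)
            (hφ _ (hpar i hi' j j.2)).1.le
    -- All the functions `φ` share `Λ`, so `δ` does not depend on `r` and `r` may tend to `ρ` at a
    -- fixed level.
    have hlim : Tendsto (fun r => Real.exp (-(2 * δ)) * r) (𝓝[<] ρ)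
        (𝓝 (Real.exp (-(2 * δ)) * ρ)) :=
      (tendsto_id.mono_left nhdsWithin_le_nhds).const_mul _
    refine le_of_tendsto hlim ?_
    filter_upwards [Ioo_mem_nhdsLT hρ] with r hr using key r hr.1 hr.2
  · have key : ∀ r, ρ < r →
        matrixSpectralRadius (scalingPattern N (k + 1) s) ≤ Real.exp (2 * δ) * r := by
      intro r hrρ
      have hr := hρ.trans hrρ
      obtain ⟨φ, hφ, hφr⟩ := hsup r hrρ
      refine matrixSpectralRadius_le hX (hg φ hφ) (by positivity) fun j => ?_
      rw [sum_mul_scalingPattern hN k s (fun r => φ (leftPt N a c (k + 1) r))]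
      rw [mul_assoc]
      refine le_trans ?_ (mul_le_mul_of_nonneg_left (hφr _ (leftPt_mem hN hac j.2.le))
        (Real.exp_pos _).le)
      rw [transferOp, Finset.mul_sum]
      refine Finset.sum_le_sum fun i hi => ?_
      have hi' := Finset.mem_range.1 hi
      have h1 := hφ.le_of_abs_sub_le (hpar i hi' j j.2) (hbm i hi' j j.2) (hdist i j)
      calc _ ≤ (Real.exp δ * φ (branch N a c i (leftPt N a c (k + 1) j))) *
            (Real.exp δ * S (branch N a c i (leftPt N a c (k + 1) j))) :=
            mul_le_mul h1 (hs i hi' j j.2).2 (hspos i hi' j j.2).le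
              (mul_nonneg (Real.exp_pos _).le (hφ _ (hbm i hi' j j.2)).1.le)
        _ = _ := by rw [show 2 * δ = δ + δ by ring, Real.exp_add]; ring
    have hlim : Tendsto (fun r => Real.exp (2 * δ) * r) (𝓝[>] ρ) (𝓝 (Real.exp (2 * δ) * ρ)) :=
      (tendsto_id.mono_left nhdsWithin_le_nhds).const_mul _
    refine ge_of_tendsto hlim ?_
    filter_upwards [self_mem_nhdsWithin] with r hr using key r hr

/-- The spectral radii of both families of vertical scaling matrices converge to the growth rate
of the transfer operator. -/
lemma tendsto_matrixSpectralRadius {N : ℕ} (hN : 2 ≤ N) {a c Λ ρ : ℝ} (hac : a ≤ c)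
    (hρ : 0 < ρ) {S : ℝ → ℝ} (hS : LogLipOn Λ (Set.Icc a c) S) (hΛ : 0 ≤ Λ)
    (hsub : ∀ r, 0 < r → r < ρ → ∃ φ, LogLipOn Λ (Set.Icc a c) φ ∧
        ∀ t ∈ Set.Icc a c, r * φ t ≤ transferOp N a c S φ t)
    (hsup : ∀ r, ρ < r → ∃ φ, LogLipOn Λ (Set.Icc a c) φ ∧
        ∀ t ∈ Set.Icc a c, transferOp N a c S φ t ≤ r * φ t) :
    Tendsto (fun k => matrixSpectralRadius (upperMatrix N a c S k)) atTop (𝓝 ρ) ∧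
      Tendsto (fun k => matrixSpectralRadius (lowerMatrix N a c S k)) atTop (𝓝 ρ) := by
  have hN0 : 0 < N := by omega
  have hδ : Tendsto (fun k : ℕ => 2 * (Λ * ((c - a) / (N : ℝ) ^ (k + 1)))) atTop (𝓝 0) := by
    have h1 : Tendsto (fun k : ℕ => (N : ℝ) ^ (k + 1)) atTop atTop :=
      (tendsto_pow_atTop_atTop_of_one_lt (by exact_mod_cast (by omega : 1 < N))).comp
        (tendsto_add_atTop_nat 1)
    simpa using ((h1.const_div_atTop (c - a)).const_mul Λ).const_mul 2
  have hlow : Tendsto (fun k : ℕ => Real.exp (-(2 * (Λ * ((c - a) / (N : ℝ) ^ (k + 1))))) * ρ)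
      atTop (𝓝 ρ) := by
    simpa using ((Real.continuous_exp.tendsto _).comp hδ.neg).mul_const ρ
  have hupp : Tendsto (fun k : ℕ => Real.exp (2 * (Λ * ((c - a) / (N : ℝ) ^ (k + 1)))) * ρ)
      atTop (𝓝 ρ) := by
    simpa using ((Real.continuous_exp.tendsto _).comp hδ).mul_const ρ
  constructor
  · rw [← tendsto_add_atTop_iff_nat 1]
    have h := fun k => matrixSpectralRadius_scalingPattern hN0 hac hρ hS hΛ hsub hsup k
      (sUpper N a c S (k + 1)) rfl fun i hi j hj => sUpper_bounds hN0 hac hΛ hS hi hj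
    exact tendsto_of_tendsto_of_tendsto_of_le_of_le hlow hupp (fun k => (h k).1) fun k => (h k).2
  · rw [← tendsto_add_atTop_iff_nat 1]
    have h := fun k => matrixSpectralRadius_scalingPattern hN0 hac hρ hS hΛ hsub hsup k
      (sLower N a c S (k + 1)) rfl fun i hi j hj => sLower_bounds hN0 hac hΛ hS hi hj
    exact tendsto_of_tendsto_of_tendsto_of_le_of_le hlow hupp (fun k => (h k).1) fun k => (h k).2

/-! ### Growth of the total oscillation -/

lemma LogLipOn.exists_bounds {a c Λ : ℝ} (hac : a ≤ c) (hΛ : 0 ≤ Λ) {φ : ℝ → ℝ}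
    (hφ : LogLipOn Λ (Set.Icc a c) φ) :
    ∃ β B : ℝ, 0 < β ∧ 0 < B ∧ ∀ t ∈ Set.Icc a c, β ≤ φ t ∧ φ t ≤ B := by
  have haI : a ∈ Set.Icc a c := Set.left_mem_Icc.2 hac
  have ha := (hφ a haI).1
  refine ⟨Real.exp (-(Λ * (c - a))) * φ a, Real.exp (Λ * (c - a)) * φ a, by positivity,
    by positivity, fun t ht => ?_⟩
  have h1 : Λ * |t - a| ≤ Λ * (c - a) := by
    refine mul_le_mul_of_nonneg_left ?_ hΛ
    rw [abs_of_nonneg (by linarith [ht.1])]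
    linarith [ht.2]
  refine ⟨?_, hφ.le_of_abs_sub_le ht haI h1⟩
  rw [Real.exp_neg, inv_mul_le_iff₀ (Real.exp_pos _)]
  exact hφ.le_of_abs_sub_le haI ht (by rw [abs_sub_comm]; exact h1)

lemma subInterval_succ_eq_image {N : ℕ} (hN : 0 < N) (a c : ℝ) (k i j : ℕ) :
    subInterval N a c (k + 1) (i * N ^ k + j) = branch N a c i '' subInterval N a c k j := by
  have hN' : (0 : ℝ) < N := by exact_mod_cast hN
  have hle : ∀ s t, branch N a c i s ≤ branch N a c i t ↔ s ≤ t := fun s t => by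
    rw [branch, branch, add_le_add_iff_left, div_le_div_iff_of_pos_right hN',
      sub_le_sub_iff_right]
  rw [subInterval_eq, subInterval_eq, add_assoc, ← branch_leftPt hN, ← branch_leftPt hN]
  ext t
  constructor
  · intro ht
    have he : branch N a c i (a + N * (t - a - (i : ℝ) / N * (c - a))) = t := by
      unfold branch; field_simp; ring
    rw [← he] at ht ⊢
    exact ⟨_, ⟨(hle _ _).1 ht.1, (hle _ _).1 ht.2⟩, rfl⟩
  · rintro ⟨s, hs, rfl⟩
    exact ⟨(hle _ _).2 hs.1, (hle _ _).2 hs.2⟩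

lemma isBounded_image_subInterval {N : ℕ} (hN : 0 < N) {a c : ℝ} (hac : a ≤ c) {f : ℝ → ℝ}
    (hf : ContinuousOn f (Set.Icc a c)) {k j : ℕ} (hj : j < N ^ k) :
    Bornology.IsBounded (f '' subInterval N a c k j) :=
  ((isCompact_Icc.image_of_continuousOn hf).isBounded).subset
    (Set.image_mono (subInterval_subset hN hac hj))

lemma oscillation_nonneg (f : ℝ → ℝ) (U : Set ℝ) : 0 ≤ oscillation f U := Metric.diam_nonneg

lemma abs_sub_le_oscillation {f : ℝ → ℝ} {U : Set ℝ} (hU : Bornology.IsBounded (f '' U))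
    {s t : ℝ} (hs : s ∈ U) (ht : t ∈ U) : |f s - f t| ≤ oscillation f U := by
  rw [← Real.dist_eq]
  exact Metric.dist_le_diam_of_mem hU ⟨s, hs, rfl⟩ ⟨t, ht, rfl⟩

lemma oscillation_le {f : ℝ → ℝ} {U : Set ℝ} {r : ℝ} (hr : 0 ≤ r)
    (h : ∀ s ∈ U, ∀ t ∈ U, |f s - f t| ≤ r) : oscillation f U ≤ r := by
  refine Metric.diam_le_of_forall_dist_le hr ?_
  rintro _ ⟨s, hs, rfl⟩ _ ⟨t, ht, rfl⟩
  rw [Real.dist_eq]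
  exact h s hs t ht

/-- `f` is approximately self-affine: on the `i`-th branch, increments of `f` are those of `f`
scaled by `S`, up to an error of first order. -/
def ApproxSelfAffine (N : ℕ) (a c : ℝ) (S f : ℝ → ℝ) (C : ℝ) : Prop :=
  ∀ i < N, ∀ u ∈ Set.Icc a c, ∀ s ∈ Set.Icc a c, ∀ t ∈ Set.Icc a c, ∀ r : ℝ,
    |s - u| ≤ r → |t - u| ≤ r →
      |(f (branch N a c i s) - f (branch N a c i t)) - S (branch N a c i u) * (f s - f t)| ≤ C * r

/-- A branch carries cells onto cells, and `ApproxSelfAffine` based at the left end compares all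
increments at once. The lower estimate recovers the parent's oscillation by dividing by the value of
`S`, which uses its positivity. -/
lemma oscillation_branch {N : ℕ} (hN : 0 < N) {a c C : ℝ} (hac : a ≤ c) {S f : ℝ → ℝ}
    (hS : ∀ t ∈ Set.Icc a c, 0 < S t) (hf : ContinuousOn f (Set.Icc a c)) (hC : 0 ≤ C)
    (hfS : ApproxSelfAffine N a c S f C) {k i j : ℕ} (hi : i < N) (hj : j < N ^ k) :
    |oscillation f (subInterval N a c (k + 1) (i * N ^ k + j)) -
      S (leftPt N a c (k + 1) (i * N ^ k + j)) * oscillation f (subInterval N a c k j)| ≤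
      C * ((c - a) / N ^ k) := by
  have hw : 0 ≤ (c - a) / (N : ℝ) ^ k := div_nonneg (sub_nonneg.2 hac) (by positivity)
  have hpt := leftPt_mem hN hac hj.le (a := a) (c := c)
  have hSp := hS _ (branch_mem hi hpt)
  have hb := isBounded_image_subInterval hN hac hf hj
  have hb' := isBounded_image_subInterval hN hac hf (add_lt_pow_succ hi hj)
  rw [← branch_leftPt hN]
  set σ := S (branch N a c i (leftPt N a c k j)) with hσ
  have hloc : ∀ t ∈ subInterval N a c k j, |t - leftPt N a c k j| ≤ (c - a) / (N : ℝ) ^ k := by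
    intro t ht
    rw [subInterval_eq, leftPt_succ] at ht
    rw [abs_of_nonneg (by linarith [ht.1])]
    linarith [ht.2]
  have hsub := subInterval_subset hN hac hj
  have hkey : ∀ s ∈ subInterval N a c k j, ∀ t ∈ subInterval N a c k j,
      |(f (branch N a c i s) - f (branch N a c i t)) - σ * (f s - f t)| ≤
        C * ((c - a) / N ^ k) := fun s hs t ht =>
    hfS i hi _ hpt s (hsub hs) t (hsub ht) _ (hloc s hs) (hloc t ht)
  rw [subInterval_succ_eq_image hN] at hb' ⊢
  rw [abs_le]
  constructor
  · have h1 : oscillation f (subInterval N a c k j) ≤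
        (oscillation f (branch N a c i '' subInterval N a c k j) + C * ((c - a) / N ^ k)) / σ := by
      refine oscillation_le (div_nonneg (add_nonneg (oscillation_nonneg _ _)
        (mul_nonneg hC hw)) hSp.le) fun s hs t ht => ?_
      rw [le_div_iff₀ hSp]
      have h2 := abs_sub_le_oscillation hb' (Set.mem_image_of_mem (branch N a c i) hs)
        (Set.mem_image_of_mem (branch N a c i) ht)
      have h3 := hkey s hs t ht
      have h4 : |σ * (f s - f t)| = |f s - f t| * σ := by rw [abs_mul, abs_of_pos hSp, mul_comm]
      rw [← h4]
      have h5 := abs_sub_abs_le_abs_sub (σ * (f s - f t))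
        (f (branch N a c i s) - f (branch N a c i t))
      rw [abs_sub_comm (σ * (f s - f t))] at h5
      linarith
    rw [le_div_iff₀ hSp] at h1
    linarith
  · have h1 : oscillation f (branch N a c i '' subInterval N a c k j) ≤
        σ * oscillation f (subInterval N a c k j) + C * ((c - a) / N ^ k) := by
      refine oscillation_le (add_nonneg (mul_nonneg hSp.le (oscillation_nonneg _ _))
        (mul_nonneg hC hw)) ?_
      rintro _ ⟨s, hs, rfl⟩ _ ⟨t, ht, rfl⟩
      have h2 := mul_le_mul_of_nonneg_left (abs_sub_le_oscillation hb hs ht) hSp.le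
      have h3 := hkey s hs t ht
      have h4 : |σ * (f s - f t)| = σ * |f s - f t| := by rw [abs_mul, abs_of_pos hSp]
      have h5 := abs_sub_abs_le_abs_sub (f (branch N a c i s) - f (branch N a c i t))
        (σ * (f s - f t))
      linarith
    linarith

/-- The total oscillation weighted by the values of `φ` at left end points. -/
def weightedOsc (N : ℕ) (a c : ℝ) (φ f : ℝ → ℝ) (k : ℕ) : ℝ :=
  ∑ j ∈ Finset.range (N ^ k), φ (leftPt N a c k j) * oscillation f (subInterval N a c k j)

/-- Duality: grouping the level `k + 1` cells by branch moves the factor `S` onto the weight, which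
becomes the transfer operator of `φ`. There are `N ^ (k + 1)` errors of size `B * C * (c - a) / N ^
k`, so the total is bounded independently of `k`. -/
lemma abs_weightedOsc_succ_sub {N : ℕ} (hN : 0 < N) {a c C B : ℝ} (hac : a ≤ c) {S φ f : ℝ → ℝ}
    (hS : ∀ t ∈ Set.Icc a c, 0 < S t) (hf : ContinuousOn f (Set.Icc a c)) (hC : 0 ≤ C)
    (hfS : ApproxSelfAffine N a c S f C) (hφ : ∀ t ∈ Set.Icc a c, 0 ≤ φ t ∧ φ t ≤ B) (k : ℕ) :
    |weightedOsc N a c φ f (k + 1) - weightedOsc N a c (transferOp N a c S φ) f k| ≤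
      N * B * C * (c - a) := by
  have hNk : (0 : ℝ) < (N : ℝ) ^ k := by positivity
  have hB : 0 ≤ B := (hφ a (Set.left_mem_Icc.2 hac)).1.trans (hφ a (Set.left_mem_Icc.2 hac)).2
  have hw : 0 ≤ (c - a) / (N : ℝ) ^ k := div_nonneg (sub_nonneg.2 hac) hNk.le
  have h1 : weightedOsc N a c φ f (k + 1) = ∑ i ∈ Finset.range N, ∑ j ∈ Finset.range (N ^ k),
      φ (leftPt N a c (k + 1) (i * N ^ k + j)) *
        oscillation f (subInterval N a c (k + 1) (i * N ^ k + j)) := by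
    rw [weightedOsc, pow_succ', sum_range_mul_eq]
  have h2 : weightedOsc N a c (transferOp N a c S φ) f k =
      ∑ i ∈ Finset.range N, ∑ j ∈ Finset.range (N ^ k),
      φ (leftPt N a c (k + 1) (i * N ^ k + j)) *
        (S (leftPt N a c (k + 1) (i * N ^ k + j)) * oscillation f (subInterval N a c k j)) := by
    simp only [weightedOsc, transferOp, Finset.sum_mul, branch_leftPt hN]
    rw [Finset.sum_comm]
    exact Finset.sum_congr rfl fun _ _ => Finset.sum_congr rfl fun _ _ => by ring
  rw [h1, h2, ← Finset.sum_sub_distrib]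
  refine (Finset.abs_sum_le_sum_abs _ _).trans ?_
  have h3 : ∀ i ∈ Finset.range N, |(∑ j ∈ Finset.range (N ^ k),
      φ (leftPt N a c (k + 1) (i * N ^ k + j)) *
        oscillation f (subInterval N a c (k + 1) (i * N ^ k + j))) -
      ∑ j ∈ Finset.range (N ^ k), φ (leftPt N a c (k + 1) (i * N ^ k + j)) *
        (S (leftPt N a c (k + 1) (i * N ^ k + j)) * oscillation f (subInterval N a c k j))| ≤
      B * C * (c - a) := by
    intro i hi
    rw [← Finset.sum_sub_distrib]
    refine (Finset.abs_sum_le_sum_abs _ _).trans ?_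
    have h4 : ∀ j ∈ Finset.range (N ^ k), |φ (leftPt N a c (k + 1) (i * N ^ k + j)) *
        oscillation f (subInterval N a c (k + 1) (i * N ^ k + j)) -
        φ (leftPt N a c (k + 1) (i * N ^ k + j)) *
        (S (leftPt N a c (k + 1) (i * N ^ k + j)) * oscillation f (subInterval N a c k j))| ≤
        B * (C * ((c - a) / N ^ k)) := by
      intro j hj
      have hi' := Finset.mem_range.1 hi
      have hj' := Finset.mem_range.1 hj
      obtain ⟨h5, h6⟩ := hφ _ (leftPt_mem hN hac (add_lt_pow_succ hi' hj').le)
      rw [← mul_sub, abs_mul, abs_of_nonneg h5]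
      exact mul_le_mul h6 (oscillation_branch hN hac hS hf hC hfS hi' hj') (abs_nonneg _) hB
    refine (Finset.sum_le_sum h4).trans (le_of_eq ?_)
    rw [Finset.sum_const, Finset.card_range, nsmul_eq_mul]
    push_cast
    field_simp
  refine (Finset.sum_le_sum h3).trans (le_of_eq ?_)
  rw [Finset.sum_const, Finset.card_range, nsmul_eq_mul]
  ring

/-- The fixed point of the affine recursion is `-C / (r - 1)`; measured from it, `x` grows by a
factor of at most `r`. -/
lemma le_mul_pow_of_succ_le {r C : ℝ} (hr : 1 < r) (hC : 0 ≤ C) {x : ℕ → ℝ}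
    (h : ∀ p, x (p + 1) ≤ r * x p + C) (p : ℕ) : x p ≤ (x 0 + C / (r - 1)) * r ^ p := by
  have hr' : 0 < r - 1 := by linarith
  have key : x p + C / (r - 1) ≤ (x 0 + C / (r - 1)) * r ^ p := by
    induction p with
    | zero => simp
    | succ p ih =>
      have e : C / (r - 1) * r = C + C / (r - 1) := by field_simp; ring
      calc x (p + 1) + C / (r - 1) ≤ (x p + C / (r - 1)) * r := by linarith [h p]
        _ ≤ (x 0 + C / (r - 1)) * r ^ p * r := by gcongr
        _ = _ := by ring
  have : 0 ≤ C / (r - 1) := div_nonneg hC hr'.le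
  linarith

/-- Once `x` exceeds the threshold `C / (r - 1)`, its excess is multiplied by at least `r` at each
step. Divergence is used only to cross that threshold. -/
lemma exists_mul_pow_le_of_le_succ {r C : ℝ} (hr : 1 < r) (hC : 0 ≤ C) {x : ℕ → ℝ}
    (h : ∀ p, r * x p - C ≤ x (p + 1)) (hx : Tendsto x atTop atTop) :
    ∃ κ > 0, ∀ᶠ p in atTop, κ * r ^ p ≤ x p := by
  have hr' : 0 < r - 1 := by linarith
  obtain ⟨q, hq⟩ := (hx.eventually_ge_atTop (C / (r - 1) + 1)).exists
  have key : ∀ n, r ^ n ≤ x (q + n) - C / (r - 1) := by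
    intro n
    induction n with
    | zero => simp only [pow_zero, add_zero]; linarith
    | succ n ih =>
      have e : C / (r - 1) * r = C + C / (r - 1) := by field_simp; ring
      have h1 := mul_le_mul_of_nonneg_right ih (by linarith : 0 ≤ r)
      rw [pow_succ, ← add_assoc]
      linarith [h (q + n)]
  refine ⟨(r ^ q)⁻¹, by positivity, ?_⟩
  filter_upwards [eventually_ge_atTop q] with p hp
  obtain ⟨n, rfl⟩ := Nat.exists_eq_add_of_le hp
  rw [pow_add, inv_mul_cancel_left₀ (by positivity)]
  have : 0 ≤ C / (r - 1) := div_nonneg hC hr'.le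
  linarith [key n]

lemma weightedOsc_bounds {N : ℕ} (hN : 0 < N) {a c β B : ℝ} (hac : a ≤ c) {φ f : ℝ → ℝ}
    (hφ : ∀ t ∈ Set.Icc a c, β ≤ φ t ∧ φ t ≤ B) (k : ℕ) :
    β * totalOsc N k f a c ≤ weightedOsc N a c φ f k ∧
      weightedOsc N a c φ f k ≤ B * totalOsc N k f a c := by
  unfold totalOsc weightedOsc
  rw [Finset.mul_sum, Finset.mul_sum]
  have h : ∀ j ∈ Finset.range (N ^ k), leftPt N a c k j ∈ Set.Icc a c := fun j hj =>
    leftPt_mem hN hac (Finset.mem_range.1 hj).le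
  exact ⟨Finset.sum_le_sum fun j hj =>
      mul_le_mul_of_nonneg_right (hφ _ (h j hj)).1 (oscillation_nonneg _ _),
    Finset.sum_le_sum fun j hj =>
      mul_le_mul_of_nonneg_right (hφ _ (h j hj)).2 (oscillation_nonneg _ _)⟩

lemma weightedOsc_mono {N : ℕ} (hN : 0 < N) {a c : ℝ} (hac : a ≤ c) {φ ψ f : ℝ → ℝ}
    (h : ∀ t ∈ Set.Icc a c, φ t ≤ ψ t) (k : ℕ) :
    weightedOsc N a c φ f k ≤ weightedOsc N a c ψ f k :=
  Finset.sum_le_sum fun _ hj => mul_le_mul_of_nonneg_right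
    (h _ (leftPt_mem hN hac (Finset.mem_range.1 hj).le)) (oscillation_nonneg _ _)

lemma weightedOsc_const_mul (N : ℕ) (a c r : ℝ) (φ f : ℝ → ℝ) (k : ℕ) :
    weightedOsc N a c (fun t => r * φ t) f k = r * weightedOsc N a c φ f k := by
  simp only [weightedOsc, Finset.mul_sum, mul_assoc]

lemma exists_totalOsc_le {N : ℕ} (hN : 0 < N) {a c C Λ r : ℝ} (hac : a ≤ c) {S φ f : ℝ → ℝ}
    (hS : ∀ t ∈ Set.Icc a c, 0 < S t) (hf : ContinuousOn f (Set.Icc a c)) (hC : 0 ≤ C)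
    (hfS : ApproxSelfAffine N a c S f C) (hΛ : 0 ≤ Λ) (hφ : LogLipOn Λ (Set.Icc a c) φ)
    (hr : 1 < r) (hφr : ∀ t ∈ Set.Icc a c, transferOp N a c S φ t ≤ r * φ t) :
    ∃ D, ∀ p, totalOsc N p f a c ≤ D * r ^ p := by
  obtain ⟨β, B, hβ, hB, hbd⟩ := hφ.exists_bounds hac hΛ
  have hbd' : ∀ t ∈ Set.Icc a c, 0 ≤ φ t ∧ φ t ≤ B := fun t ht =>
    ⟨hβ.le.trans (hbd t ht).1, (hbd t ht).2⟩
  have hE : 0 ≤ N * B * C * (c - a) := by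
    have := sub_nonneg.2 hac
    positivity
  have hrec : ∀ p, weightedOsc N a c φ f (p + 1) ≤
      r * weightedOsc N a c φ f p + N * B * C * (c - a) := by
    intro p
    have h1 := (abs_le.1 (abs_weightedOsc_succ_sub hN hac hS hf hC hfS hbd' p)).2
    have h2 := weightedOsc_mono (f := f) hN hac hφr p
    rw [weightedOsc_const_mul] at h2
    linarith
  refine ⟨(weightedOsc N a c φ f 0 + N * B * C * (c - a) / (r - 1)) / β, fun p => ?_⟩
  have h3 := le_mul_pow_of_succ_le hr hE hrec p
  have h4 := (weightedOsc_bounds (f := f) hN hac hbd p).1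
  rw [div_mul_eq_mul_div, le_div_iff₀ hβ]
  linarith

lemma exists_le_totalOsc {N : ℕ} (hN : 0 < N) {a c C Λ r : ℝ} (hac : a ≤ c) {S φ f : ℝ → ℝ}
    (hS : ∀ t ∈ Set.Icc a c, 0 < S t) (hf : ContinuousOn f (Set.Icc a c)) (hC : 0 ≤ C)
    (hfS : ApproxSelfAffine N a c S f C) (hΛ : 0 ≤ Λ) (hφ : LogLipOn Λ (Set.Icc a c) φ)
    (hr : 1 < r) (hφr : ∀ t ∈ Set.Icc a c, r * φ t ≤ transferOp N a c S φ t)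
    (htop : Tendsto (fun p => totalOsc N p f a c) atTop atTop) :
    ∃ κ > 0, ∀ᶠ p in atTop, κ * r ^ p ≤ totalOsc N p f a c := by
  obtain ⟨β, B, hβ, hB, hbd⟩ := hφ.exists_bounds hac hΛ
  have hbd' : ∀ t ∈ Set.Icc a c, 0 ≤ φ t ∧ φ t ≤ B := fun t ht =>
    ⟨hβ.le.trans (hbd t ht).1, (hbd t ht).2⟩
  have hE : 0 ≤ N * B * C * (c - a) := by
    have := sub_nonneg.2 hac
    positivity
  have hrec : ∀ p, r * weightedOsc N a c φ f p - N * B * C * (c - a) ≤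
      weightedOsc N a c φ f (p + 1) := by
    intro p
    have h1 := (abs_le.1 (abs_weightedOsc_succ_sub hN hac hS hf hC hfS hbd' p)).1
    have h2 := weightedOsc_mono (f := f) hN hac hφr p
    rw [weightedOsc_const_mul] at h2
    linarith
  have hwtop : Tendsto (fun p => weightedOsc N a c φ f p) atTop atTop :=
    tendsto_atTop_mono (fun p => (weightedOsc_bounds (f := f) hN hac hbd p).1)
      (htop.const_mul_atTop hβ)
  obtain ⟨κ, hκ, hev⟩ := exists_mul_pow_le_of_le_succ hr hE hrec hwtop
  refine ⟨κ / B, div_pos hκ hB, ?_⟩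
  filter_upwards [hev] with p hp
  have h4 := (weightedOsc_bounds (f := f) hN hac hbd p).2
  rw [div_mul_eq_mul_div, div_le_iff₀ hB]
  linarith

lemma leftPt_mono {N : ℕ} {a c : ℝ} (hac : a ≤ c) (k : ℕ) : Monotone (leftPt N a c k) := by
  intro i j hij
  have : (i : ℝ) ≤ j := by exact_mod_cast hij
  unfold leftPt
  have := sub_nonneg.2 hac
  gcongr

lemma oscillation_Icc_le_sum {N : ℕ} {a c : ℝ} (hac : a ≤ c) (f : ℝ → ℝ) (k q n : ℕ) :
    oscillation f (Set.Icc (leftPt N a c k q) (leftPt N a c k (q + n))) ≤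
      ∑ m ∈ Finset.range n, oscillation f (subInterval N a c k (q + m)) := by
  induction n with
  | zero => simp [oscillation]
  | succ n ih =>
    rw [Finset.sum_range_succ, ← add_assoc]
    have h1 := leftPt_mono (N := N) hac k (Nat.le_add_right q n)
    have h2 := leftPt_mono (N := N) hac k (Nat.le_succ (q + n))
    have h3 : oscillation f (Set.Icc (leftPt N a c k q) (leftPt N a c k (q + n + 1))) ≤
        oscillation f (Set.Icc (leftPt N a c k q) (leftPt N a c k (q + n))) +
          oscillation f (subInterval N a c k (q + n)) := by
      rw [subInterval_eq, ← Set.Icc_union_Icc_eq_Icc h1 h2, oscillation, Set.image_union]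
      exact Metric.diam_union'
        ⟨f (leftPt N a c k (q + n)), ⟨_, ⟨h1, le_rfl⟩, rfl⟩, ⟨_, ⟨le_rfl, h2⟩, rfl⟩⟩
    linarith

/-- Each cell is a chain of `N` finer cells with common end points, so its oscillation is at most
the sum of theirs. Monotonicity gives the dichotomy between divergence and boundedness. -/
lemma totalOsc_mono {N : ℕ} (hN : 0 < N) {a c : ℝ} (hac : a ≤ c) (f : ℝ → ℝ) :
    Monotone (fun p => totalOsc N p f a c) := by
  refine monotone_nat_of_le_succ fun p => ?_
  have hN' : (N : ℝ) ≠ 0 := by positivity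
  unfold totalOsc
  rw [pow_succ, sum_range_mul_eq]
  refine Finset.sum_le_sum fun j _ => ?_
  have e : ∀ j : ℕ, leftPt N a c p j = leftPt N a c (p + 1) (j * N) := fun j => by
    unfold leftPt; push_cast; rw [pow_succ, mul_div_mul_right _ _ hN']
  rw [subInterval_eq, e, e, Nat.succ_mul]
  exact oscillation_Icc_le_sum hac f (p + 1) (j * N) N

lemma totalOsc_nonneg (N p : ℕ) (f : ℝ → ℝ) (a c : ℝ) : 0 ≤ totalOsc N p f a c :=
  Finset.sum_nonneg fun _ _ => oscillation_nonneg _ _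

/-! ### Counting boxes -/

lemma card_Icc_ceil_floor_le {p q : ℝ} (h : 0 ≤ q - p + 1) :
    ((Finset.Icc ⌈p⌉ ⌊q⌋).card : ℝ) ≤ q - p + 1 := by
  rw [Int.card_Icc]
  rcases le_total 0 (⌊q⌋ + 1 - ⌈p⌉) with h0 | h0
  · have h1 : (((⌊q⌋ + 1 - ⌈p⌉).toNat : ℤ) : ℝ) = ((⌊q⌋ + 1 - ⌈p⌉ : ℤ) : ℝ) := by
      rw [Int.toNat_of_nonneg h0]
    rw [Int.cast_natCast] at h1
    rw [h1]
    push_cast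
    linarith [Int.floor_le q, Int.le_ceil p]
  · rw [Int.toNat_eq_zero.2 h0]
    simpa using h

lemma mem_Icc_ceil_floor {ε α β t : ℝ} (hε : 0 < ε) {k : ℤ} (ht : t ∈ Set.Icc α β)
    (hk : t ∈ Set.Icc (k * ε) ((k + 1) * ε)) : k ∈ Finset.Icc ⌈α / ε - 1⌉ ⌊β / ε⌋ := by
  rw [Finset.mem_Icc, Int.ceil_le, Int.le_floor, le_div_iff₀ hε, sub_le_iff_le_add,
    div_le_iff₀ hε]
  exact ⟨ht.1.trans hk.2, hk.1.trans ht.2⟩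

lemma exists_mem_subInterval_of_mem_Icc {N : ℕ} {a c : ℝ} (k n : ℕ) {t : ℝ}
    (ht : t ∈ Set.Icc (leftPt N a c k 0) (leftPt N a c k (n + 1))) :
    ∃ j < n + 1, t ∈ subInterval N a c k j := by
  induction n with
  | zero => exact ⟨0, by omega, by rw [subInterval_eq]; exact ht⟩
  | succ n ih =>
    rcases le_total t (leftPt N a c k (n + 1)) with h | h
    · obtain ⟨j, hj, hjt⟩ := ih ⟨ht.1, h⟩
      exact ⟨j, by omega, hjt⟩
    · exact ⟨n + 1, by omega, by rw [subInterval_eq]; exact ⟨h, ht.2⟩⟩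

lemma exists_mem_subInterval {N : ℕ} (hN : 0 < N) {a c : ℝ} (k : ℕ) {t : ℝ}
    (ht : t ∈ Set.Icc a c) : ∃ j < N ^ k, t ∈ subInterval N a c k j := by
  obtain ⟨n, hn⟩ := Nat.exists_eq_succ_of_ne_zero (pow_pos hN k).ne'
  rw [hn]
  refine exists_mem_subInterval_of_mem_Icc k n ?_
  have h0 : leftPt N a c k 0 = a := by simp [leftPt]
  have h1 : leftPt N a c k (n + 1) = c := by
    have : ((n + 1 : ℕ) : ℝ) = (N : ℝ) ^ k := by rw [← Nat.succ_eq_add_one, ← hn]; push_cast; rfl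
    rw [leftPt, this, div_self (by positivity)]
    ring
  rwa [h0, h1]

/-- The indices of the `ε`-squares meeting the graph of `f` over `[a, c]`. -/
def boxIndices (a c : ℝ) (f : ℝ → ℝ) (ε : ℝ) : Set (ℤ × ℤ) :=
  {k | (coordSquare ε k ∩ (Set.Icc a c).graphOn f).Nonempty}

lemma mem_boxIndices {a c : ℝ} {f : ℝ → ℝ} {ε : ℝ} {k : ℤ × ℤ} :
    k ∈ boxIndices a c f ε ↔ ∃ t ∈ Set.Icc a c,
      t ∈ Set.Icc (k.1 * ε) ((k.1 + 1) * ε) ∧ f t ∈ Set.Icc (k.2 * ε) ((k.2 + 1) * ε) := by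
  constructor
  · rintro ⟨_, hk, t, ht, rfl⟩
    exact ⟨t, ht, hk.1, hk.2⟩
  · rintro ⟨t, ht, h1, h2⟩
    exact ⟨(t, f t), ⟨h1, h2⟩, t, ht, rfl⟩

/-- Over a cell of width at most `ε` and oscillation `o`, the graph meets at most `3` columns and `2
* o / ε + 2` rows. Finiteness is recorded because `Set.ncard` is `0` on infinite sets, so the lower
bounds depend on it. -/
lemma boxCount_le {N : ℕ} (hN : 0 < N) {a c ε : ℝ} (hac : a ≤ c) {f : ℝ → ℝ}
    (hf : ContinuousOn f (Set.Icc a c)) (hε : 0 < ε) {k : ℕ} (hk : (c - a) / (N : ℝ) ^ k ≤ ε) :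
    (boxIndices a c f ε).Finite ∧
      (boxCount ((Set.Icc a c).graphOn f) ε : ℝ) ≤ 6 * (totalOsc N k f a c / ε + N ^ k) := by
  set o : ℕ → ℝ := fun j => oscillation f (subInterval N a c k j) with ho
  set F : ℕ → Finset (ℤ × ℤ) := fun j =>
    Finset.Icc ⌈leftPt N a c k j / ε - 1⌉ ⌊leftPt N a c k (j + 1) / ε⌋ ×ˢ
      Finset.Icc ⌈(f (leftPt N a c k j) - o j) / ε - 1⌉ ⌊(f (leftPt N a c k j) + o j) / ε⌋ with hF
  have hsub : boxIndices a c f ε ⊆ ((Finset.range (N ^ k)).biUnion F : Finset (ℤ × ℤ)) := by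
    intro q hq
    obtain ⟨t, ht, h1, h2⟩ := mem_boxIndices.1 hq
    obtain ⟨j, hj, hjt⟩ := exists_mem_subInterval hN k ht
    simp only [Finset.coe_biUnion, Set.mem_iUnion, Finset.mem_coe]
    refine ⟨j, Finset.mem_range.2 hj, ?_⟩
    have hleft : leftPt N a c k j ∈ subInterval N a c k j := by
      rw [subInterval_eq]
      exact Set.left_mem_Icc.2 (leftPt_mono hac k (Nat.le_succ j))
    have h3 := abs_le.1 (abs_sub_le_oscillation (isBounded_image_subInterval hN hac hf hj)
      hjt hleft)
    rw [subInterval_eq] at hjt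
    rw [Finset.mem_product]
    refine ⟨mem_Icc_ceil_floor hε hjt h1, mem_Icc_ceil_floor hε ⟨?_, ?_⟩ h2⟩
    · simp only [ho]; linarith [h3.1]
    · simp only [ho]; linarith [h3.2]
  refine ⟨(Finset.finite_toSet _).subset hsub, ?_⟩
  have hcard : ∀ j, ((F j).card : ℝ) ≤ 6 * (o j / ε + 1) := by
    intro j
    have ho0 : 0 ≤ o j / ε := div_nonneg (oscillation_nonneg _ _) hε.le
    have hstep : leftPt N a c k (j + 1) / ε - leftPt N a c k j / ε ≤ 1 := by
      rw [← sub_div, leftPt_succ, add_sub_cancel_left, div_le_one hε]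
      exact hk
    have hstep0 : leftPt N a c k j / ε ≤ leftPt N a c k (j + 1) / ε :=
      div_le_div_of_nonneg_right (leftPt_mono hac k (Nat.le_succ j)) hε.le
    have e : (f (leftPt N a c k j) + o j) / ε - (f (leftPt N a c k j) - o j) / ε =
        2 * (o j / ε) := by ring
    have h1 := card_Icc_ceil_floor_le (p := leftPt N a c k j / ε - 1)
      (q := leftPt N a c k (j + 1) / ε) (by linarith)
    have h2 := card_Icc_ceil_floor_le (p := (f (leftPt N a c k j) - o j) / ε - 1)
      (q := (f (leftPt N a c k j) + o j) / ε) (by linarith)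
    rw [hF, Finset.card_product, Nat.cast_mul]
    calc _ ≤ (3 : ℝ) * (2 * (o j / ε) + 2) :=
          mul_le_mul (by linarith) (by linarith) (Nat.cast_nonneg _) (by norm_num)
      _ = _ := by ring
  have h1 : boxCount ((Set.Icc a c).graphOn f) ε ≤ ∑ j ∈ Finset.range (N ^ k), (F j).card := by
    refine le_trans ?_ Finset.card_biUnion_le
    rw [← Set.ncard_coe_finset]
    exact Set.ncard_le_ncard hsub (Finset.finite_toSet _)
  calc (boxCount ((Set.Icc a c).graphOn f) ε : ℝ)
      ≤ ∑ j ∈ Finset.range (N ^ k), ((F j).card : ℝ) := by exact_mod_cast h1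
    _ ≤ ∑ j ∈ Finset.range (N ^ k), 6 * (o j / ε + 1) := Finset.sum_le_sum fun j _ => hcard j
    _ = 6 * (totalOsc N k f a c / ε + N ^ k) := by
        rw [← Finset.mul_sum, Finset.sum_add_distrib, ← Finset.sum_div]
        simp [totalOsc, ho]

/-- By the intermediate value theorem the graph over a cell meets every row between its minimum and
its maximum. -/
lemma exists_column_indices {N : ℕ} (hN : 0 < N) {a c ε : ℝ} (hac : a ≤ c) {f : ℝ → ℝ}
    (hf : ContinuousOn f (Set.Icc a c)) (hε : 0 < ε) {k j : ℕ} (hj : j < N ^ k) :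
    ∃ B : Finset ℤ, 1 ≤ (B.card : ℝ) ∧
      oscillation f (subInterval N a c k j) / ε ≤ B.card ∧
      ∀ q ∈ B, ∃ t ∈ subInterval N a c k j, f t ∈ Set.Icc (q * ε) ((q + 1) * ε) := by
  have hsub := subInterval_subset hN hac hj
  have hne : (subInterval N a c k j).Nonempty := by
    rw [subInterval_eq]
    exact Set.nonempty_Icc.2 (leftPt_mono hac k (Nat.le_succ j))
  have hcomp : IsCompact (subInterval N a c k j) := isCompact_Icc
  have hconn : IsPreconnected (subInterval N a c k j) := isPreconnected_Icc
  obtain ⟨u, hu, humin⟩ := hcomp.exists_isMinOn hne (hf.mono hsub)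
  obtain ⟨v, hv, hvmax⟩ := hcomp.exists_isMaxOn hne (hf.mono hsub)
  have huv : f u ≤ f v := humin hv
  have hosc : oscillation f (subInterval N a c k j) ≤ f v - f u := by
    refine oscillation_le (by linarith) fun s hs t ht => ?_
    have h1 : f u ≤ f s := humin hs
    have h2 : f u ≤ f t := humin ht
    have h3 : f s ≤ f v := hvmax hs
    have h4 : f t ≤ f v := hvmax ht
    rw [abs_le]
    constructor <;> linarith
  have hfl : ⌊f u / ε⌋ ≤ ⌊f v / ε⌋ := Int.floor_le_floor (div_le_div_of_nonneg_right huv hε.le)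
  have hcard : ((Finset.Icc ⌊f u / ε⌋ ⌊f v / ε⌋).card : ℝ) = ⌊f v / ε⌋ + 1 - ⌊f u / ε⌋ := by
    rw [Int.card_Icc]
    have h1 : (((⌊f v / ε⌋ + 1 - ⌊f u / ε⌋).toNat : ℤ) : ℝ) =
        ((⌊f v / ε⌋ + 1 - ⌊f u / ε⌋ : ℤ) : ℝ) := by
      rw [Int.toNat_of_nonneg (by omega)]
    rw [Int.cast_natCast] at h1
    rw [h1]
    push_cast
    ring
  refine ⟨Finset.Icc ⌊f u / ε⌋ ⌊f v / ε⌋, ?_, ?_, fun q hq => ?_⟩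
  · rw [hcard]
    have : (⌊f u / ε⌋ : ℝ) ≤ ⌊f v / ε⌋ := by exact_mod_cast hfl
    linarith
  · rw [hcard]
    have h1 := div_le_div_of_nonneg_right hosc hε.le
    rw [sub_div] at h1
    linarith [Int.floor_le (f u / ε), Int.lt_floor_add_one (f v / ε)]
  · obtain ⟨hq1, hq2⟩ := Finset.mem_Icc.1 hq
    have h1 : (q : ℝ) * ε ≤ f v := by
      rw [← le_div_iff₀ hε]; exact Int.le_floor.1 hq2
    have h2 : f u ≤ (q + 1) * ε := by
      rw [← div_le_iff₀ hε]
      have : (⌊f u / ε⌋ : ℝ) ≤ q := by exact_mod_cast hq1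
      linarith [Int.lt_floor_add_one (f u / ε)]
    -- The maximum handles the lowest row, whose bottom edge may lie below the range of `f` on the
    -- cell.
    obtain ⟨t, ht, hty⟩ := hconn.intermediate_value hu hv (hf.mono hsub)
      (show max (f u) (q * ε) ∈ Set.Icc (f u) (f v) from ⟨le_max_left _ _, max_le huv h1⟩)
    refine ⟨t, ht, ?_⟩
    rw [hty]
    exact ⟨le_max_right _ _, max_le h2 (by nlinarith)⟩

/-- Choose a square for each pair of a cell and a row met over it. A square no wider than a cell
meets at most three cells, so it is chosen at most three times. -/
lemma le_boxCount {N : ℕ} (hN : 0 < N) {a c ε : ℝ} (hac : a ≤ c) {f : ℝ → ℝ}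
    (hf : ContinuousOn f (Set.Icc a c)) (hε : 0 < ε) {k : ℕ} (hk : ε ≤ (c - a) / (N : ℝ) ^ k)
    (hfin : (boxIndices a c f ε).Finite) :
    (N : ℝ) ^ k ≤ 3 * boxCount ((Set.Icc a c).graphOn f) ε ∧
      totalOsc N k f a c / ε ≤ 3 * boxCount ((Set.Icc a c).graphOn f) ε := by
  have hex : ∀ j, ∃ B : Finset ℤ, j < N ^ k → 1 ≤ (B.card : ℝ) ∧
      oscillation f (subInterval N a c k j) / ε ≤ B.card ∧
      ∀ q ∈ B, ∃ t ∈ subInterval N a c k j, f t ∈ Set.Icc (q * ε) ((q + 1) * ε) := by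
    intro j
    by_cases hj : j < N ^ k
    · obtain ⟨B, hB⟩ := exists_column_indices hN hac hf hε hj
      exact ⟨B, fun _ => hB⟩
    · exact ⟨∅, fun h => absurd h hj⟩
  choose B hB using hex
  have hex2 : ∀ (j : ℕ) (q : ℤ), ∃ t : ℝ, j < N ^ k → q ∈ B j →
      t ∈ subInterval N a c k j ∧ f t ∈ Set.Icc (q * ε) ((q + 1) * ε) := by
    intro j q
    by_cases h : j < N ^ k ∧ q ∈ B j
    · obtain ⟨t, h1, h2⟩ := (hB j h.1).2.2 q h.2
      exact ⟨t, fun _ _ => ⟨h1, h2⟩⟩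
    · exact ⟨0, fun h1 h2 => absurd ⟨h1, h2⟩ h⟩
  choose τ hτ using hex2
  set T : Finset (Σ _ : ℕ, ℤ) := (Finset.range (N ^ k)).sigma B with hT
  set Φ : (Σ _ : ℕ, ℤ) → ℤ × ℤ := fun x => (⌊τ x.1 x.2 / ε⌋, x.2) with hΦ
  have hfloor : ∀ s : ℝ, s ∈ Set.Icc ((⌊s / ε⌋ : ℝ) * ε) ((⌊s / ε⌋ + 1) * ε) := fun s =>
    ⟨by rw [← le_div_iff₀ hε]; exact Int.floor_le _,
      by rw [← div_le_iff₀ hε]; exact (Int.lt_floor_add_one _).le⟩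
  have himg : ((T.image Φ : Finset (ℤ × ℤ)) : Set (ℤ × ℤ)) ⊆ boxIndices a c f ε := by
    intro p hp
    obtain ⟨⟨j, q⟩, hx, rfl⟩ := Finset.mem_image.1 (Finset.mem_coe.1 hp)
    obtain ⟨hj, hq⟩ := Finset.mem_sigma.1 hx
    have hj' := Finset.mem_range.1 hj
    obtain ⟨h1, h2⟩ := hτ j q hj' hq
    exact mem_boxIndices.2 ⟨τ j q, subInterval_subset hN hac hj' h1, hfloor _, h2⟩
  have he : 0 < (c - a) / (N : ℝ) ^ k := hε.trans_le hk
  have hfib : ∀ p ∈ T.image Φ, (T.filter fun x => Φ x = p).card ≤ 3 := by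
    intro p _
    set e := (c - a) / (N : ℝ) ^ k with he'
    set R := Finset.Icc ⌈(p.1 * ε - a) / e - 1⌉ ⌊((p.1 + 1) * ε - a) / e⌋ with hR
    have hRcard : R.card ≤ 3 := by
      have e1 : ((p.1 + 1) * ε - a) / e - (p.1 * ε - a) / e = ε / e := by ring
      have e2 : ε / e ≤ 1 := (div_le_one he).2 hk
      have e3 : 0 ≤ ε / e := by positivity
      have h1 := card_Icc_ceil_floor_le (p := (p.1 * ε - a) / e - 1)
        (q := ((p.1 + 1) * ε - a) / e) (by linarith)
      have h2 : (R.card : ℝ) ≤ 3 := by linarith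
      exact_mod_cast h2
    refine le_trans (Finset.card_le_card_of_injOn (fun x => (x.1 : ℤ)) ?_ ?_) hRcard
    · intro x hx
      obtain ⟨hxT, hxp⟩ := Finset.mem_filter.1 (Finset.mem_coe.1 hx)
      obtain ⟨hj, hq⟩ := Finset.mem_sigma.1 hxT
      have h1 := (hτ x.1 x.2 (Finset.mem_range.1 hj) hq).1
      have h2 := hfloor (τ x.1 x.2)
      have h3 : ⌊τ x.1 x.2 / ε⌋ = p.1 := congrArg Prod.fst hxp
      rw [h3] at h2
      rw [subInterval_eq, leftPt_succ] at h1
      have e4 : leftPt N a c k x.1 = a + x.1 * e := by rw [leftPt, he']; ring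
      rw [e4] at h1
      rw [Finset.mem_coe, hR, Finset.mem_Icc, Int.ceil_le, Int.le_floor, sub_le_iff_le_add,
        div_le_iff₀ he, le_div_iff₀ he]
      push_cast
      constructor
      · linarith [h1.2, h2.1]
      · linarith [h1.1, h2.2]
    · intro x hx y hy hxy
      have h1 := (Finset.mem_filter.1 (Finset.mem_coe.1 hx)).2
      have h2 := (Finset.mem_filter.1 (Finset.mem_coe.1 hy)).2
      have h3 : x.2 = y.2 := congrArg Prod.snd (h1.trans h2.symm)
      have h4 : x.1 = y.1 := Nat.cast_injective (R := ℤ) hxy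
      exact Sigma.ext h4 (heq_of_eq h3)
  have hTcard : T.card ≤ 3 * boxCount ((Set.Icc a c).graphOn f) ε := by
    refine (Finset.card_le_mul_card_image T 3 hfib).trans (Nat.mul_le_mul_left 3 ?_)
    rw [← Set.ncard_coe_finset]
    exact Set.ncard_le_ncard himg hfin
  have hTcard' : (∑ j ∈ Finset.range (N ^ k), ((B j).card : ℝ)) ≤
      3 * boxCount ((Set.Icc a c).graphOn f) ε := by
    rw [hT, Finset.card_sigma] at hTcard
    exact_mod_cast hTcard
  constructor
  · refine le_trans ?_ hTcard'
    have h1 := Finset.sum_le_sum fun j hj => (hB j (Finset.mem_range.1 hj)).1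
    simpa using h1
  · refine le_trans ?_ hTcard'
    rw [totalOsc, Finset.sum_div]
    exact Finset.sum_le_sum fun j hj => (hB j (Finset.mem_range.1 hj)).2.1

/-! ### From box counts to box dimension -/

lemma tendsto_log_one_div : Tendsto (fun ε : ℝ => Real.log (1 / ε)) (𝓝[>] 0) atTop := by
  simp only [one_div]
  exact Real.tendsto_log_atTop.comp tendsto_inv_nhdsGT_zero

/-- The strict gap between `d'` and `b` absorbs `log κ`, which is negligible against `log (1 / ε)`.
Exponents merely near `d` suffice, as the oscillation estimates hold only for rates near `ρ`. -/
lemma hasBoxDim_of_bounds {E : Set (ℝ × ℝ)} {d : ℝ}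
    (hlow : ∀ b < d, ∃ d' > b, ∃ κ > 0, ∀ᶠ ε in 𝓝[>] (0 : ℝ), κ * (1 / ε) ^ d' ≤ boxCount E ε)
    (hupp : ∀ b > d, ∃ d' < b, ∃ κ > 0, ∀ᶠ ε in 𝓝[>] (0 : ℝ),
      (boxCount E ε : ℝ) ≤ κ * (1 / ε) ^ d') :
    HasBoxDim E d := by
  have hpos : ∀ᶠ ε in 𝓝[>] (0 : ℝ), 0 < (boxCount E ε : ℝ) := by
    obtain ⟨d', _, κ, hκ, h⟩ := hlow (d - 1) (by linarith)
    filter_upwards [h, self_mem_nhdsWithin] with ε h1 (h2 : 0 < ε)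
    exact lt_of_lt_of_le (by positivity) h1
  have hlim : Tendsto (fun ε : ℝ => Real.log (boxCount E ε) / Real.log (1 / ε)) (𝓝[>] 0)
      (𝓝 d) := by
    refine tendsto_order.2 ⟨fun b hb => ?_, fun b hb => ?_⟩
    · obtain ⟨d', hd', κ, hκ, h⟩ := hlow b hb
      filter_upwards [h, self_mem_nhdsWithin, tendsto_log_one_div.eventually_gt_atTop 0,
        tendsto_log_one_div.eventually_gt_atTop (-Real.log κ / (d' - b))]
        with ε h1 (h2 : 0 < ε) h3 h4
      have hx : 0 < 1 / ε := by positivity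
      have h5 := Real.log_le_log (by positivity) h1
      rw [Real.log_mul hκ.ne' (Real.rpow_pos_of_pos hx _).ne', Real.log_rpow hx] at h5
      rw [div_lt_iff₀ (by linarith)] at h4
      rw [lt_div_iff₀ h3]
      linarith
    · obtain ⟨d', hd', κ, hκ, h⟩ := hupp b hb
      filter_upwards [h, self_mem_nhdsWithin, tendsto_log_one_div.eventually_gt_atTop 0,
        tendsto_log_one_div.eventually_gt_atTop (Real.log κ / (b - d')), hpos]
        with ε h1 (h2 : 0 < ε) h3 h4 h0
      have hx : 0 < 1 / ε := by positivity
      have h5 := Real.log_le_log h0 h1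
      rw [Real.log_mul hκ.ne' (Real.rpow_pos_of_pos hx _).ne', Real.log_rpow hx] at h5
      rw [div_lt_iff₀ (by linarith)] at h4
      rw [div_lt_iff₀ h3]
      linarith
  have hlimE : Tendsto (fun ε : ℝ =>
      ((Real.log (boxCount E ε) / Real.log (1 / ε) : ℝ) : EReal)) (𝓝[>] 0) (𝓝 (d : EReal)) :=
    (continuous_coe_real_ereal.tendsto d).comp hlim
  exact ⟨hlimE.liminf_eq, hlimE.limsup_eq⟩

lemma exists_pow_near {N : ℕ} (hN : 2 ≤ N) {a c : ℝ} (hac : a < c) (P : ℕ) :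
    ∀ᶠ ε in 𝓝[>] (0 : ℝ), 0 < ε ∧ ∃ p ≥ P, (c - a) / (N : ℝ) ^ (p + 1) ≤ ε ∧
      ε ≤ (c - a) / (N : ℝ) ^ p := by
  have hN1 : (1 : ℝ) < N := by exact_mod_cast (by omega : 1 < N)
  have hN0 : (0 : ℝ) < N := by linarith
  have hw : 0 < c - a := by linarith
  have hlt : 0 < (c - a) / (N : ℝ) ^ P := by positivity
  filter_upwards [Ioo_mem_nhdsGT hlt] with ε ⟨hε, hεP⟩
  refine ⟨hε, ?_⟩
  rw [lt_div_iff₀ (by positivity), mul_comm, ← lt_div_iff₀ hε] at hεP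
  obtain ⟨p, hp1, hp2⟩ := exists_nat_pow_near
    ((one_le_pow₀ hN1.le : (1 : ℝ) ≤ (N : ℝ) ^ P).trans hεP.le) hN1
  refine ⟨p, ?_, ?_, ?_⟩
  · have := (pow_lt_pow_iff_right₀ hN1).1 (hεP.trans hp2)
    omega
  · rw [div_lt_iff₀ hε] at hp2
    rw [div_le_iff₀ (by positivity)]
    linarith
  · rw [le_div_iff₀ hε] at hp1
    rw [le_div_iff₀ (by positivity)]
    linarith

lemma finite_boxIndices {N : ℕ} (hN : 2 ≤ N) {a c : ℝ} (hac : a < c) {f : ℝ → ℝ}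
    (hf : ContinuousOn f (Set.Icc a c)) {ε : ℝ} (hε : 0 < ε) {p : ℕ}
    (hp : (c - a) / (N : ℝ) ^ p ≤ ε) : (boxIndices a c f ε).Finite :=
  (boxCount_le (by omega) hac.le hf hε hp).1

lemma rpow_pow_comm {x d : ℝ} (hx : 0 ≤ x) (p : ℕ) : (x ^ d) ^ p = (x ^ p) ^ d := by
  rw [← Real.rpow_natCast, ← Real.rpow_natCast, ← Real.rpow_mul hx, ← Real.rpow_mul hx, mul_comm]

lemma rpow_eq_mul_rpow_sub_one {x : ℝ} (hx : 0 < x) (d : ℝ) : x ^ d = x * x ^ (d - 1) := by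
  nth_rw 2 [← Real.rpow_one x]
  rw [← Real.rpow_add hx]
  ring_nf

/-- At `ε ≈ N ^ (-p)` the oscillation term is of order `N ^ p * N ^ ((d - 1) * p) = N ^ (d * p)`,
and `1 ≤ d` lets it absorb the term `N ^ p`. -/
lemma exists_boxCount_le {N : ℕ} (hN : 2 ≤ N) {a c d D : ℝ} (hac : a < c) {f : ℝ → ℝ}
    (hf : ContinuousOn f (Set.Icc a c)) (hd : 1 ≤ d)
    (hD : ∀ p, totalOsc N p f a c ≤ D * ((N : ℝ) ^ (d - 1)) ^ p) :
    ∃ κ > 0, ∀ᶠ ε in 𝓝[>] (0 : ℝ),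
      (boxCount ((Set.Icc a c).graphOn f) ε : ℝ) ≤ κ * (1 / ε) ^ d := by
  have hN1 : (1 : ℝ) < N := by exact_mod_cast (by omega : 1 < N)
  have hN0 : (0 : ℝ) < N := by linarith
  have hw : 0 < c - a := by linarith
  have hD0 : 0 ≤ D := by simpa using (totalOsc_nonneg N 0 f a c).trans (hD 0)
  set r := (N : ℝ) ^ (d - 1) with hr
  have hr1 : 1 ≤ r := Real.one_le_rpow hN1.le (by linarith)
  have hNr : (N : ℝ) ^ d = N * r := rpow_eq_mul_rpow_sub_one hN0 d
  refine ⟨6 * (D / (c - a) + 1) * (N * r) * (c - a) ^ d, by positivity, ?_⟩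
  filter_upwards [exists_pow_near hN hac 0] with ε ⟨hε, p, _, hp1, hp2⟩
  have h1 := (boxCount_le (by omega) hac.le hf hε hp1).2
  have hinv : 1 / ε ≤ (N : ℝ) ^ (p + 1) / (c - a) := by
    rw [div_le_div_iff₀ hε hw]
    rw [div_le_iff₀ (by positivity)] at hp1
    linarith
  have h2 : totalOsc N (p + 1) f a c / ε ≤ D * r ^ (p + 1) * ((N : ℝ) ^ (p + 1) / (c - a)) := by
    rw [div_eq_mul_one_div]
    exact mul_le_mul (hD _) hinv (by positivity) (by positivity)
  have h3 : (N : ℝ) ^ (p + 1) ≤ r ^ (p + 1) * (N : ℝ) ^ (p + 1) :=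
    le_mul_of_one_le_left (by positivity) (one_le_pow₀ hr1)
  have h4 : (N * r) ^ p ≤ (c - a) ^ d * (1 / ε) ^ d := by
    rw [← hNr, rpow_pow_comm hN0.le, ← Real.mul_rpow hw.le (by positivity)]
    refine Real.rpow_le_rpow (by positivity) ?_ (by linarith)
    rw [le_div_iff₀ (by positivity)] at hp2
    rw [mul_one_div, le_div_iff₀ hε]
    linarith
  calc (boxCount ((Set.Icc a c).graphOn f) ε : ℝ)
      ≤ 6 * (totalOsc N (p + 1) f a c / ε + (N : ℝ) ^ (p + 1)) := h1
    _ ≤ 6 * (D * r ^ (p + 1) * ((N : ℝ) ^ (p + 1) / (c - a)) +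
        r ^ (p + 1) * (N : ℝ) ^ (p + 1)) := by linarith
    _ = 6 * (D / (c - a) + 1) * (N * r) * (N * r) ^ p := by ring
    _ ≤ 6 * (D / (c - a) + 1) * (N * r) * ((c - a) ^ d * (1 / ε) ^ d) :=
        mul_le_mul_of_nonneg_left h4 (by positivity)
    _ = _ := by ring

lemma exists_le_boxCount_one {N : ℕ} (hN : 2 ≤ N) {a c : ℝ} (hac : a < c) {f : ℝ → ℝ}
    (hf : ContinuousOn f (Set.Icc a c)) :
    ∃ κ > 0, ∀ᶠ ε in 𝓝[>] (0 : ℝ),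
      κ * (1 / ε) ^ (1 : ℝ) ≤ boxCount ((Set.Icc a c).graphOn f) ε := by
  have hN0 : (0 : ℝ) < N := by exact_mod_cast (by omega : 0 < N)
  have hw : 0 < c - a := by linarith
  refine ⟨(c - a) / (3 * N), by positivity, ?_⟩
  filter_upwards [exists_pow_near hN hac 0] with ε ⟨hε, p, _, hp1, hp2⟩
  have h1 := (le_boxCount (by omega) hac.le hf hε hp2 (finite_boxIndices hN hac hf hε hp1)).1
  rw [Real.rpow_one]
  rw [div_le_iff₀ (by positivity), pow_succ] at hp1
  rw [div_mul_div_comm, mul_one, div_le_iff₀ (by positivity)]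
  calc c - a ≤ (N : ℝ) ^ p * (N * ε) := by linarith
    _ ≤ 3 * (boxCount ((Set.Icc a c).graphOn f) ε : ℝ) * (N * ε) :=
        mul_le_mul_of_nonneg_right h1 (by positivity)
    _ = _ := by ring

lemma exists_le_boxCount {N : ℕ} (hN : 2 ≤ N) {a c d κ : ℝ} (hac : a < c) {f : ℝ → ℝ}
    (hf : ContinuousOn f (Set.Icc a c)) (hd : 1 ≤ d) (hκ : 0 < κ)
    (hO : ∀ᶠ p in atTop, κ * ((N : ℝ) ^ (d - 1)) ^ p ≤ totalOsc N p f a c) :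
    ∃ κ' > 0, ∀ᶠ ε in 𝓝[>] (0 : ℝ),
      κ' * (1 / ε) ^ d ≤ boxCount ((Set.Icc a c).graphOn f) ε := by
  have hN0 : (0 : ℝ) < N := by exact_mod_cast (by omega : 0 < N)
  have hw : 0 < c - a := by linarith
  set r := (N : ℝ) ^ (d - 1) with hr
  have hr0 : 0 < r := Real.rpow_pos_of_pos hN0 _
  have hNr : (N : ℝ) ^ d = N * r := rpow_eq_mul_rpow_sub_one hN0 d
  obtain ⟨P, hP⟩ := eventually_atTop.1 hO
  refine ⟨κ * (c - a) ^ d / (3 * (c - a) * (N * r)), by positivity, ?_⟩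
  filter_upwards [exists_pow_near hN hac P] with ε ⟨hε, p, hpP, hp1, hp2⟩
  have h1 := (le_boxCount (by omega) hac.le hf hε hp2 (finite_boxIndices hN hac hf hε hp1)).2
  have h2 := hP p hpP
  have hinv : (N : ℝ) ^ p / (c - a) ≤ 1 / ε := by
    rw [div_le_div_iff₀ hw hε]
    rw [le_div_iff₀ (by positivity)] at hp2
    linarith
  have h4 : (c - a) ^ d * (1 / ε) ^ d ≤ (N * r) ^ (p + 1) := by
    rw [← hNr, rpow_pow_comm hN0.le, ← Real.mul_rpow hw.le (by positivity)]
    refine Real.rpow_le_rpow (by positivity) ?_ (by linarith)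
    rw [div_le_iff₀ (by positivity)] at hp1
    rw [mul_one_div, div_le_iff₀ hε]
    linarith
  have h5 : κ * r ^ p * ((N : ℝ) ^ p / (c - a)) ≤
      3 * (boxCount ((Set.Icc a c).graphOn f) ε : ℝ) := by
    refine le_trans ?_ h1
    rw [div_eq_mul_one_div (totalOsc N p f a c)]
    exact mul_le_mul h2 hinv (by positivity) (totalOsc_nonneg _ _ _ _ _)
  have h6 : κ * (N * r) ^ p ≤ 3 * (c - a) * (boxCount ((Set.Icc a c).graphOn f) ε : ℝ) := by
    have : κ * (N * r) ^ p = κ * r ^ p * ((N : ℝ) ^ p / (c - a)) * (c - a) := by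
      rw [mul_pow]; field_simp
    rw [this]
    nlinarith
  rw [div_mul_eq_mul_div, div_le_iff₀ (by positivity)]
  calc κ * (c - a) ^ d * (1 / ε) ^ d = κ * ((c - a) ^ d * (1 / ε) ^ d) := by ring
    _ ≤ κ * (N * r) ^ (p + 1) := mul_le_mul_of_nonneg_left h4 hκ.le
    _ = κ * (N * r) ^ p * (N * r) := by ring
    _ ≤ 3 * (c - a) * (boxCount ((Set.Icc a c).graphOn f) ε : ℝ) * (N * r) :=
        mul_le_mul_of_nonneg_right h6 (by positivity)
    _ = _ := by ring

/-! ### Generalized affine fractal interpolation functions -/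

lemma node_eq {N : ℕ} {x : Fin (N + 1) → ℝ}
    (hunif : ∀ i : Fin N, x i.succ - x i.castSucc = (x (Fin.last N) - x 0) / (N : ℝ))
    (i : Fin (N + 1)) : x i = x 0 + (i : ℝ) / N * (x (Fin.last N) - x 0) := by
  induction i using Fin.induction with
  | zero => simp
  | succ i ih =>
    have h1 := hunif i
    rw [ih] at h1
    simp only [Fin.val_succ, Fin.val_castSucc] at h1 ⊢
    push_cast
    linear_combination h1

namespace IsGeneralizedAffineFIF

variable {N : ℕ} {x y : Fin (N + 1) → ℝ} {b h : ℝ → ℝ} {L : Fin N → ℝ → ℝ} {S f : ℝ → ℝ}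

lemma L_eq_branch (hf : IsGeneralizedAffineFIF x y b h L S f) (hx : x 0 < x (Fin.last N))
    (hunif : ∀ i : Fin N, x i.succ - x i.castSucc = (x (Fin.last N) - x 0) / (N : ℝ))
    (i : Fin N) {t : ℝ} (ht : t ∈ nodeInterval x) :
    L i t = branch N (x 0) (x (Fin.last N)) i t := by
  obtain ⟨m, d, hL⟩ := hf.L_linear i
  have h1 := hf.L_left i
  have h2 := hf.L_right i
  rw [hL _ (Set.left_mem_Icc.2 hx.le)] at h1
  rw [hL _ (Set.right_mem_Icc.2 hx.le)] at h2
  have h3 := hunif i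
  have h4 := node_eq hunif i.castSucc
  rw [Fin.val_castSucc] at h4
  have hm : m = 1 / N := by
    have h5 : m * (x (Fin.last N) - x 0) = 1 / N * (x (Fin.last N) - x 0) := by
      linear_combination h2 - h1 + h3
    exact mul_right_cancel₀ (by linarith) h5
  rw [hL t ht, branch, ← h4, ← h1, hm]
  ring

/-- The image of a graph point under the `i`-th map is again on the graph; only this inclusion of
the invariance is needed. -/
lemma functional_eq (hf : IsGeneralizedAffineFIF x y b h L S f) (hx : x 0 < x (Fin.last N))
    (hunif : ∀ i : Fin N, x i.succ - x i.castSucc = (x (Fin.last N) - x 0) / (N : ℝ))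
    (i : Fin N) {t : ℝ} (ht : t ∈ nodeInterval x) :
    f (branch N (x 0) (x (Fin.last N)) i t) =
      S (branch N (x 0) (x (Fin.last N)) i t) * (f t - b t) +
        h (branch N (x 0) (x (Fin.last N)) i t) := by
  have h1 : ifsMap b h S (L i) (t, f t) ∈ (nodeInterval x).graphOn f := by
    rw [hf.graph_invariant]
    exact Set.mem_iUnion.2 ⟨i, (t, f t), ⟨t, ht, rfl⟩, rfl⟩
  obtain ⟨s, _, hs⟩ := h1
  simp only [ifsMap, Prod.mk.injEq] at hs
  rw [hf.L_eq_branch hx hunif i ht] at hs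
  rw [← hs.2, ← hs.1]

/-- Subtracting two functional equations leaves variations of `S` multiplied by the bounded function
`f - b`, plus increments of `b` and of `h`. The latter are affine on the relevant pieces, so every
term is of first order. -/
lemma approxSelfAffine (hf : IsGeneralizedAffineFIF x y b h L S f) (hx : x 0 < x (Fin.last N))
    (hunif : ∀ i : Fin N, x i.succ - x i.castSucc = (x (Fin.last N) - x 0) / (N : ℝ))
    {K : NNReal} (hK : LipschitzOnWith K S (nodeInterval x)) :
    ∃ C, 0 ≤ C ∧ ApproxSelfAffine N (x 0) (x (Fin.last N)) S f C := by
  obtain ⟨mb, cb, hb⟩ := hf.b_linear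
  choose mh ch hh using hf.h_linear
  have hcont : ContinuousOn (fun t => f t - (mb * t + cb)) (nodeInterval x) :=
    hf.f_continuous.sub (by fun_prop)
  obtain ⟨G, hG⟩ := isCompact_Icc.exists_bound_of_continuousOn hcont
  have hG' : ∀ t ∈ nodeInterval x, |f t - b t| ≤ G := fun t ht => by
    rw [hb t ht]; exact hG t ht
  have hG0 : 0 ≤ G := (abs_nonneg _).trans (hG' (x 0) (Set.left_mem_Icc.2 hx.le))
  set H := ∑ i, |mh i| with hH
  have hH0 : 0 ≤ H := Finset.sum_nonneg fun i _ => abs_nonneg _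
  -- `S` is varied at both `s` and `t`, giving `2 * K * G`; the other factors `2` come from `|s - t|
  -- ≤ 2r`. `H` bounds the slope of `h` on every piece.
  refine ⟨2 * K * G + 2 * |mb| + 2 * H, by positivity, ?_⟩
  intro i hi u hu s hs t ht r hsr htr
  have hN : (1 : ℝ) ≤ N := by exact_mod_cast (by omega : 1 ≤ N)
  have hr : 0 ≤ r := (abs_nonneg _).trans hsr
  have hbm : ∀ v ∈ nodeInterval x, branch N (x 0) (x (Fin.last N)) i v ∈ nodeInterval x :=
    fun v hv => branch_mem hi hv
  have hhb : ∀ v ∈ nodeInterval x, h (branch N (x 0) (x (Fin.last N)) i v) =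
      mh ⟨i, hi⟩ * branch N (x 0) (x (Fin.last N)) i v + ch ⟨i, hi⟩ := by
    intro v hv
    refine hh ⟨i, hi⟩ _ ?_
    have e1 := node_eq hunif (Fin.castSucc ⟨i, hi⟩)
    have e2 := hunif ⟨i, hi⟩
    rw [Fin.val_castSucc] at e1
    have h0 : (0 : ℝ) < N := by linarith
    have h1 : 0 ≤ (v - x 0) / N := div_nonneg (sub_nonneg.2 hv.1) h0.le
    have h2 : (v - x 0) / N ≤ (x (Fin.last N) - x 0) / N :=
      div_le_div_of_nonneg_right (by linarith [hv.2]) h0.le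
    rw [branch]
    constructor <;> linarith
  have hbr : ∀ v w, |branch N (x 0) (x (Fin.last N)) i v -
      branch N (x 0) (x (Fin.last N)) i w| ≤ |v - w| := by
    intro v w
    rw [branch_sub_branch, abs_div, abs_of_pos (by linarith : (0 : ℝ) < N)]
    exact div_le_self (abs_nonneg _) hN
  have hst : |s - t| ≤ r * 2 := by
    have := abs_sub_le s u t
    rw [abs_sub_comm u t] at this
    linarith
  have hSv : ∀ v ∈ nodeInterval x, |v - u| ≤ r →
      |(S (branch N (x 0) (x (Fin.last N)) i v) - S (branch N (x 0) (x (Fin.last N)) i u)) *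
        (f v - b v)| ≤ K * r * G := by
    intro v hv hvr
    have h1 := hK.dist_le_mul _ (hbm v hv) _ (hbm u hu)
    rw [Real.dist_eq, Real.dist_eq] at h1
    have h2 := (hbr v u).trans hvr
    rw [abs_mul]
    exact mul_le_mul (h1.trans (by gcongr)) (hG' v hv) (abs_nonneg _) (by positivity)
  have hS1 := (hf.S_abs_lt_one _ (hbm u hu)).le
  have h3 : |S (branch N (x 0) (x (Fin.last N)) i u) * (b s - b t)| ≤ 1 * (|mb| * (r * 2)) := by
    rw [abs_mul, hb s hs, hb t ht, show mb * s + cb - (mb * t + cb) = mb * (s - t) by ring,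
      abs_mul]
    gcongr
  have h4 : |h (branch N (x 0) (x (Fin.last N)) i s) - h (branch N (x 0) (x (Fin.last N)) i t)| ≤
      H * (r * 2) := by
    rw [hhb s hs, hhb t ht, add_sub_add_right_eq_sub, ← mul_sub, abs_mul]
    exact mul_le_mul (Finset.single_le_sum (f := fun i => |mh i|) (fun i _ => abs_nonneg _)
      (Finset.mem_univ _)) ((hbr s t).trans hst) (abs_nonneg _) hH0
  have h1 := hSv s hs hsr
  have h2 := hSv t ht htr
  have es := hf.functional_eq hx hunif ⟨i, hi⟩ hs
  have et := hf.functional_eq hx hunif ⟨i, hi⟩ ht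
  simp only at es et
  rw [es, et]
  rw [abs_le] at h1 h2 h3 h4 ⊢
  constructor <;> nlinarith

end IsGeneralizedAffineFIF

/-! ### Growth rates as powers of `N`, and the dimension formula -/

lemma log_div_log_lt_iff {N : ℕ} (hN : 2 ≤ N) {ρ s : ℝ} (hρ : 0 < ρ) :
    Real.log ρ / Real.log N < s ↔ ρ < (N : ℝ) ^ s := by
  have hN1 : (1 : ℝ) < N := by exact_mod_cast (by omega : 1 < N)
  have hN0 : (0 : ℝ) < N := by linarith
  rw [div_lt_iff₀ (Real.log_pos hN1), ← Real.log_rpow hN0,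
    Real.log_lt_log_iff hρ (Real.rpow_pos_of_pos hN0 _)]

lemma lt_log_div_log_iff {N : ℕ} (hN : 2 ≤ N) {ρ s : ℝ} (hρ : 0 < ρ) :
    s < Real.log ρ / Real.log N ↔ (N : ℝ) ^ s < ρ := by
  have hN1 : (1 : ℝ) < N := by exact_mod_cast (by omega : 1 < N)
  have hN0 : (0 : ℝ) < N := by linarith
  rw [lt_div_iff₀ (Real.log_pos hN1), ← Real.log_rpow hN0,
    Real.log_lt_log_iff (Real.rpow_pos_of_pos hN0 _) hρ]

end FIF

end

theorem theorem4p10 (N : ℕ) (hN : 2 ≤ N) (x y : Fin (N + 1) → ℝ) (hx : StrictMono x)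
    (b h : ℝ → ℝ) (L : Fin N → ℝ → ℝ) (S f : ℝ → ℝ)
    (hf : FIF.IsGeneralizedAffineFIF x y b h L S f)
    (hunif : ∀ i : Fin N, x i.succ - x i.castSucc = (x (Fin.last N) - x 0) / (N : ℝ))
    (hLip : ∃ K : NNReal, LipschitzOnWith K S (FIF.nodeInterval x))
    (hpos : ∀ t ∈ FIF.nodeInterval x, 0 < S t) :
    ∃ ρ : ℝ,
      Filter.Tendsto
        (fun k : ℕ => FIF.matrixSpectralRadius (FIF.upperMatrix N (x 0) (x (Fin.last N)) S k))
        Filter.atTop (nhds ρ) ∧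
      Filter.Tendsto
        (fun k : ℕ => FIF.matrixSpectralRadius (FIF.lowerMatrix N (x 0) (x (Fin.last N)) S k))
        Filter.atTop (nhds ρ) ∧
      ((Filter.Tendsto (fun p : ℕ => FIF.totalOsc N p f (x 0) (x (Fin.last N)))
            Filter.atTop Filter.atTop ∧ 1 < ρ) →
        FIF.HasBoxDim ((FIF.nodeInterval x).graphOn f) (1 + Real.log ρ / Real.log N)) ∧
      (¬ (Filter.Tendsto (fun p : ℕ => FIF.totalOsc N p f (x 0) (x (Fin.last N)))
            Filter.atTop Filter.atTop ∧ 1 < ρ) →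
        FIF.HasBoxDim ((FIF.nodeInterval x).graphOn f) 1) := by
  have hN0 : 0 < N := by omega
  have hN1 : (1 : ℝ) < N := by exact_mod_cast (by omega : 1 < N)
  have hac : x 0 < x (Fin.last N) := hx (Fin.pos_iff_ne_zero.2 (by simp [Fin.ext_iff]; omega))
  obtain ⟨K, hK⟩ := hLip
  obtain ⟨C, hC, hfS⟩ := hf.approxSelfAffine hac hunif hK
  have hfc := hf.f_continuous
  unfold FIF.nodeInterval at hK hpos hfc ⊢
  obtain ⟨m, Λ, hm, hΛ, hmS, hSL⟩ := FIF.LogLipOn.of_lipschitzOnWith hac.le hK hpos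
  obtain ⟨ρ, hρ, hsub, hsup⟩ := FIF.exists_sub_super_eigenfunction hN hac hm hΛ hmS hSL
  obtain ⟨hlim1, hlim2⟩ := FIF.tendsto_matrixSpectralRadius hN hac.le hρ hSL hΛ hsub hsup
  refine ⟨ρ, hlim1, hlim2, ?_, ?_⟩
  · rintro ⟨htop, hρ1⟩
    have hs : 0 < Real.log ρ / Real.log N := div_pos (Real.log_pos hρ1) (Real.log_pos hN1)
    refine FIF.hasBoxDim_of_bounds (fun d hd => ?_) fun d hd => ?_
    -- Keeping `e` positive makes the rate `N ^ e` exceed `1`, as the recursion requires.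
    · obtain ⟨e, he1, he2⟩ := exists_between (max_lt hs (by linarith : d - 1 < _))
      have he0 : 0 < e := (le_max_left _ _).trans_lt he1
      have hed : d - 1 < e := (le_max_right _ _).trans_lt he1
      obtain ⟨φ, hφ, hφr⟩ := hsub ((N : ℝ) ^ e) (Real.rpow_pos_of_pos (by linarith) _)
        ((FIF.lt_log_div_log_iff hN hρ).1 he2)
      obtain ⟨κ, hκ, hO⟩ := FIF.exists_le_totalOsc hN0 hac.le hpos hfc hC hfS hΛ hφ
        (Real.one_lt_rpow hN1 he0) hφr htop
      rw [← add_sub_cancel_left 1 e] at hO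
      exact ⟨1 + e, by linarith, FIF.exists_le_boxCount hN hac hfc (by linarith) hκ hO⟩
    · obtain ⟨e, he1, he2⟩ := exists_between (by linarith : Real.log ρ / Real.log N < d - 1)
      obtain ⟨φ, hφ, hφr⟩ := hsup ((N : ℝ) ^ e) ((FIF.log_div_log_lt_iff hN hρ).1 he1)
      obtain ⟨D, hD⟩ := FIF.exists_totalOsc_le hN0 hac.le hpos hfc hC hfS hΛ hφ
        (Real.one_lt_rpow hN1 (hs.trans he1)) hφr
      rw [← add_sub_cancel_left 1 e] at hD
      exact ⟨1 + e, by linarith, FIF.exists_boxCount_le hN hac hfc (by linarith) hD⟩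
  · intro hnot
    refine FIF.hasBoxDim_of_bounds
      (fun d hd => ⟨1, hd, FIF.exists_le_boxCount_one hN hac hfc⟩) fun d hd => ?_
    obtain ⟨e, he1, he2⟩ := exists_between (sub_pos.2 hd)
    refine ⟨1 + e, by linarith, ?_⟩
    have he := Real.one_lt_rpow hN1 he1
    have hD : ∃ D, ∀ p, FIF.totalOsc N p f (x 0) (x (Fin.last N)) ≤ D * ((N : ℝ) ^ e) ^ p := by
      -- If `ρ > 1`, the oscillation must fail to diverge, hence is bounded by monotonicity.
      -- Otherwise every rate `N ^ e > 1` exceeds `ρ` and has a super-eigenfunction.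
      by_cases hρ1 : 1 < ρ
      · rcases tendsto_atTop_of_monotone (FIF.totalOsc_mono hN0 hac.le f) with htop | ⟨l, hl⟩
        · exact absurd ⟨htop, hρ1⟩ hnot
        · refine ⟨l, fun p => ?_⟩
          have h1 := (FIF.totalOsc_mono hN0 hac.le f).ge_of_tendsto hl p
          exact h1.trans (le_mul_of_one_le_right ((FIF.totalOsc_nonneg _ _ _ _ _).trans h1)
            (one_le_pow₀ he.le))
      · obtain ⟨φ, hφ, hφr⟩ := hsup ((N : ℝ) ^ e) (by linarith)
        exact FIF.exists_totalOsc_le hN0 hac.le hpos hfc hC hfS hΛ hφ he hφr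
    obtain ⟨D, hD⟩ := hD
    rw [← add_sub_cancel_left 1 e] at hD
    exact FIF.exists_boxCount_le hN hac hfc (by linarith) hD
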